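/- Let $k$ be a field, let $G$ be a discrete group (finite or infinite), and let $\mathcal F$ be a family of finite subgroups of $G$, i.e. a non-empty set of finite subgroups of $G$ closed under conjugation by elements of $G$ and under passage to subgroups. The Quillen category $\mathcal Q(G,\mathcal F)$ has the members of $\mathcal F$ as objects and $$\mathrm{Hom}(H,K)=\mathrm{Trans}_G(H,K)/C_G(H),\qquad \mathrm{Trans}_G(H,K)=\{g\in G : gHg^{-1}\subseteq K\},$$ where $C_G(H)$ acts by right multiplication, and composition is induced by multiplication in $G$. Its category algebra $k\mathcal Q(G,\mathcal F)$ has the set of all morphisms as a $k$-basis, with product $g\cdot f=g\circ f$ if this composite is defined and $g\cdot f=0$ otherwise; it is a ring that need not have a unit. A left module $M$ over a ring $S$, unital or not, is called non-degenerate if $SM=M$. We call $k\mathcal Q(G,\mathcal F)$ left hereditary if, in the category of non-degenerate left $k\mathcal Q(G,\mathcal F)$-modules, every submodule of a projective object is projective, and right hereditary if the same holds for right modules, i.e. if its opposite ring is left hereditary. Then $k\mathcal Q(G,\mathcal F)$ is left hereditary if and only if both of the following conditions hold: 1. every $K\in\mathcal F$ is cyclic of prime power order (orders $p^n$ with $p$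 prime and $n\ge 0$; in particular the trivial group is allowed, and different primes may occur); 2. for every $K\in\mathcal F$, the order of the finite group $N_G(K)/C_G(K)$ is invertible in $k$. Moreover, $k\mathcal Q(G,\mathcal F)$ is right hereditary if and only if it is left hereditary. -/

import Mathlib

open CategoryTheory

universe u v w

namespace QuillenHereditary

/-! ### The category algebra -/

section CategoryAlgebra

/-- The category algebra `kC`: the free `k`-module on the set of all morphisms of `C`. -/
def CategoryAlgebra (k : Type w) (C : Type u) [CommRing k] [Category.{v} C] : Type (max u v w) :=
  (Σ x y : C, x ⟶ y) →₀ k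

variable (k : Type w) (C : Type u) [CommRing k] [Category.{v} C]

noncomputable instance : AddCommGroup (CategoryAlgebra k C) :=
  inferInstanceAs (AddCommGroup ((Σ x y : C, x ⟶ y) →₀ k))

noncomputable instance : Module k (CategoryAlgebra k C) :=
  inferInstanceAs (Module k ((Σ x y : C, x ⟶ y) →₀ k))

variable {C}

/-- The basis element of `kC` given by a morphism. -/
noncomputable def CategoryAlgebra.of {x y : C} (f : x ⟶ y) : CategoryAlgebra k C :=
  Finsupp.single ⟨x, y, f⟩ 1

open Classical in
/-- The product `g * f` of two basis elements: the composite `g ∘ f` (first `f`, then `g`) if the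
target of `f` is the source of `g`, and `0` otherwise. -/
noncomputable def CategoryAlgebra.basisMul (g f : Σ x y : C, x ⟶ y) : CategoryAlgebra k C :=
  if h : f.2.1 = g.1 then CategoryAlgebra.of k (f.2.2 ≫ eqToHom h ≫ g.2.2) else 0

/-- The `k`-bilinear extension of `basisMul`. -/
noncomputable def CategoryAlgebra.mulHom :
    CategoryAlgebra k C →ₗ[k] CategoryAlgebra k C →ₗ[k] CategoryAlgebra k C :=
  Finsupp.linearCombination k (fun g : Σ x y : C, x ⟶ y =>
    (Finsupp.linearCombination k (fun f : Σ x y : C, x ⟶ y => CategoryAlgebra.basisMul k g f) :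
      CategoryAlgebra k C →ₗ[k] CategoryAlgebra k C))

noncomputable instance : Mul (CategoryAlgebra k C) := ⟨fun a b => CategoryAlgebra.mulHom k a b⟩

namespace CategoryAlgebra

theorem mul_def (a b : CategoryAlgebra k C) : a * b = mulHom k a b := rfl

theorem mulHom_single (g f : Σ x y : C, x ⟶ y) :
    mulHom k (of k g.2.2) (of k f.2.2) = basisMul k g f := by
  simp only [mulHom, of]
  erw [Finsupp.linearCombination_single, one_smul, Finsupp.linearCombination_single, one_smul]

theorem of_mul_of {x y z : C} (f : x ⟶ y) (g : y ⟶ z) : of k g * of k f = of k (f ≫ g) := by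
  have h := mulHom_single k (⟨y, z, g⟩ : Σ x y : C, x ⟶ y) ⟨x, y, f⟩
  simpa [basisMul, mul_def] using h

theorem of_mul_of_of_ne {x y y' z : C} (f : x ⟶ y) (g : y' ⟶ z) (h : y ≠ y') :
    of k g * of k f = 0 := by
  have h' := mulHom_single k (⟨y', z, g⟩ : Σ x y : C, x ⟶ y) ⟨x, y, f⟩
  simpa [basisMul, mul_def, h] using h'

theorem induction_of {p : CategoryAlgebra k C → Prop} (a : CategoryAlgebra k C)
    (h0 : p 0) (hadd : ∀ a b, p a → p b → p (a + b))
    (hof : ∀ (r : k) (x y : C) (f : x ⟶ y), p (r • of k f)) : p a := by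
  refine Finsupp.induction_linear (motive := p) a h0 hadd ?_
  rintro ⟨x, y, f⟩ r
  have h := hof r x y f
  have e : r • of k f = Finsupp.single (⟨x, y, f⟩ : Σ x y : C, x ⟶ y) r := by
    simp only [of]
    erw [Finsupp.smul_single, smul_eq_mul, mul_one]
  rwa [e] at h

theorem smul_mul' (r : k) (a b : CategoryAlgebra k C) : (r • a) * b = r • (a * b) := by
  simp [mul_def]

theorem mul_smul' (r : k) (a b : CategoryAlgebra k C) : a * (r • b) = r • (a * b) := by
  simp [mul_def]

theorem mul_assoc' (a b c : CategoryAlgebra k C) : a * b * c = a * (b * c) := by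
  have hl : ∀ a b c : CategoryAlgebra k C, (a + b) * c = a * c + b * c := by simp [mul_def]
  have hr : ∀ a b c : CategoryAlgebra k C, a * (b + c) = a * b + a * c := by simp [mul_def]
  have hz : ∀ a : CategoryAlgebra k C, 0 * a = 0 := by simp [mul_def]
  have hz' : ∀ a : CategoryAlgebra k C, a * 0 = 0 := by simp [mul_def]
  refine induction_of k (p := fun a => a * b * c = a * (b * c)) a (by simp only [hz]) (fun a a' h h' => by simp only [hl, h, h']) ?_
  intro r x y f
  refine induction_of k (p := fun b => r • of k f * b * c = r • of k f * (b * c)) b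
    (by simp only [hz, hz']) (fun a a' h h' => by simp only [hl, hr, h, h']) ?_
  intro s x' y' f'
  refine induction_of k (p := fun c => r • of k f * s • of k f' * c = r • of k f * (s • of k f' * c))
    c (by simp only [hz']) (fun a a' h h' => by simp only [hr, h, h']) ?_
  intro t x'' y'' f''
  simp only [smul_mul', mul_smul']
  congr 3
  by_cases h₁ : y' = x
  · subst h₁
    rw [of_mul_of]
    by_cases h₂ : y'' = x'
    · subst h₂
      rw [of_mul_of, of_mul_of, of_mul_of, Category.assoc]
    · rw [of_mul_of_of_ne k _ _ h₂, of_mul_of_of_ne k _ _ h₂, hz']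
  · rw [of_mul_of_of_ne k _ _ h₁, hz]
    by_cases h₂ : y'' = x'
    · subst h₂
      rw [of_mul_of, of_mul_of_of_ne k _ _ h₁]
    · rw [of_mul_of_of_ne k _ _ h₂, hz']

end CategoryAlgebra

noncomputable instance : NonUnitalRing (CategoryAlgebra k C) where
  left_distrib a b c := by simp [CategoryAlgebra.mul_def]
  right_distrib a b c := by simp [CategoryAlgebra.mul_def]
  zero_mul a := by simp [CategoryAlgebra.mul_def]
  mul_zero a := by simp [CategoryAlgebra.mul_def]
  mul_assoc := CategoryAlgebra.mul_assoc' k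

instance : IsScalarTower k (CategoryAlgebra k C) (CategoryAlgebra k C) :=
  ⟨fun r a b => CategoryAlgebra.smul_mul' k r a b⟩

instance : SMulCommClass k (CategoryAlgebra k C) (CategoryAlgebra k C) :=
  ⟨fun r a b => (CategoryAlgebra.mul_smul' k r a b).symm⟩

end CategoryAlgebra

/-! ### Non-degenerate modules over a non-unital ring, and hereditary rings -/

/-- A non-degenerate left module over a (not necessarily unital) ring `S`: an abelian group `M` with
a biadditive associative action of `S` such that `SM = M`. Multiplication in `AddMonoid.End M` is
composition, so `act (a * b) m = act a (act b m)`. -/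
structure NondegModule (S : Type u) [NonUnitalRing S] : Type (u + 1) where
  carrier : Type u
  [addCommGroup : AddCommGroup carrier]
  act : S →ₙ+* AddMonoid.End carrier
  nondegenerate : AddSubgroup.closure {x : carrier | ∃ (a : S) (m : carrier), act a m = x} = ⊤

attribute [instance] NondegModule.addCommGroup

namespace NondegModule

variable {S : Type u} [NonUnitalRing S]

/-- `S`-linear maps. -/
@[ext]
structure Hom (M N : NondegModule S) : Type u where
  toAddMonoidHom : M.carrier →+ N.carrier
  map_act : ∀ (a : S) (m : M.carrier), toAddMonoidHom (M.act a m) = N.act a (toAddMonoidHom m)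

/-- The category of non-degenerate left `S`-modules. -/
instance : Category (NondegModule S) where
  Hom := Hom
  id M := ⟨AddMonoidHom.id _, fun _ _ => rfl⟩
  comp f g := ⟨g.toAddMonoidHom.comp f.toAddMonoidHom, fun a m => by
    simp [f.map_act, g.map_act]⟩

end NondegModule

/-- A category is hereditary if subobjects of projective objects are projective. -/
def IsHereditaryCategory (A : Type u) [Category.{v} A] : Prop :=
  ∀ (P Q : A) (i : Q ⟶ P), Mono i → Projective P → Projective Q

/-- `S` is left hereditary: in the category of non-degenerate left `S`-modules, submodules of
projective modules are projective. -/
def IsLeftHereditary (S : Type u) [NonUnitalRing S] : Prop :=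
  IsHereditaryCategory (NondegModule S)

/-- `S` is right hereditary: the same for right `S`-modules, i.e. left modules over the opposite
ring. -/
def IsRightHereditary (S : Type u) [NonUnitalRing S] : Prop :=
  IsLeftHereditary Sᵐᵒᵖ

/-! ### Families of finite subgroups and the Quillen category -/

/-- A family of finite subgroups of `G`: a non-empty set of finite subgroups closed under conjugation
and under passage to subgroups. -/
structure FiniteSubgroupFamily (G : Type u) [Group G] where
  carrier : Set (Subgroup G)
  finite : ∀ K ∈ carrier, Finite K
  nonempty : carrier.Nonempty
  conj_mem : ∀ K ∈ carrier, ∀ g : G, K.map (MulAut.conj g).toMonoidHom ∈ carrier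
  subgroup_mem : ∀ K ∈ carrier, ∀ H : Subgroup G, H ≤ K → H ∈ carrier

section Quillen

variable {G : Type u} [Group G]

/-- The transporter `Trans_G(H, K) = {g ∈ G | g H g⁻¹ ⊆ K}`. -/
def Transporter (H K : Subgroup G) : Type u :=
  {g : G // ∀ h ∈ H, g * h * g⁻¹ ∈ K}

/-- The equivalence relation on `Trans_G(H, K)` whose classes are the cosets `g C_G(H)`. -/
def transporterSetoid (H K : Subgroup G) : Setoid (Transporter H K) where
  r a b := a.1⁻¹ * b.1 ∈ Subgroup.centralizer (H : Set G)
  iseqv :=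
    { refl := fun a => by simp [one_mem]
      symm := fun {a b} h => by simpa using inv_mem h
      trans := fun {a b c} h h' => by simpa [mul_assoc] using mul_mem h h' }

/-- `Trans_G(H, K) / C_G(H)`. -/
def QuillenHom (H K : Subgroup G) : Type u := Quotient (transporterSetoid H K)

/-- The identity morphism of `H`: the class of `1 ∈ G`. -/
def QuillenHom.id (H : Subgroup G) : QuillenHom H H :=
  Quotient.mk (transporterSetoid H H) ⟨1, fun h hh => by simpa using hh⟩

/-- Composition: the class of `g : H → K` followed by the class of `g' : K → L` is the class of
`g' * g : H → L`. -/
def QuillenHom.comp {H K L : Subgroup G} (a : QuillenHom H K) (b : QuillenHom K L) :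
    QuillenHom H L :=
  Quotient.map₂ (sa := transporterSetoid H K) (sb := transporterSetoid K L)
    (sc := transporterSetoid H L)
    (fun g g' => ⟨g'.1 * g.1, fun h hh => by
      simpa [mul_assoc] using g'.2 _ (g.2 h hh)⟩)
    (by
      rintro ⟨g₁, h₁⟩ ⟨g₂, h₂⟩ (hg : g₁⁻¹ * g₂ ∈ Subgroup.centralizer (H : Set G))
        ⟨g₁', h₁'⟩ ⟨g₂', h₂'⟩ (hg' : g₁'⁻¹ * g₂' ∈ Subgroup.centralizer (K : Set G))
      change (g₁' * g₁)⁻¹ * (g₂' * g₂) ∈ Subgroup.centralizer (H : Set G)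
      have key : g₁⁻¹ * (g₁'⁻¹ * g₂') * g₁ ∈ Subgroup.centralizer (H : Set G) := by
        rw [Subgroup.mem_centralizer_iff] at hg' ⊢
        intro h hh
        have := hg' _ (h₁ h hh)
        calc h * (g₁⁻¹ * (g₁'⁻¹ * g₂') * g₁)
            = g₁⁻¹ * ((g₁ * h * g₁⁻¹) * (g₁'⁻¹ * g₂')) * g₁ := by group
          _ = g₁⁻¹ * ((g₁'⁻¹ * g₂') * (g₁ * h * g₁⁻¹)) * g₁ := by rw [this]
          _ = g₁⁻¹ * (g₁'⁻¹ * g₂') * g₁ * h := by group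
      have := mul_mem key hg
      convert this using 1
      group) a b

/-- The Quillen category `Q(G, F)`: its objects are the members of `F`. -/
def QuillenCategory (F : FiniteSubgroupFamily G) : Type u := {K : Subgroup G // K ∈ F.carrier}

instance (F : FiniteSubgroupFamily G) : Category.{u} (QuillenCategory F) where
  Hom H K := QuillenHom H.1 K.1
  id H := QuillenHom.id H.1
  comp a b := QuillenHom.comp a b
  id_comp := by
    rintro H K ⟨g⟩
    exact congrArg (Quotient.mk (transporterSetoid H.1 K.1)) (Subtype.ext (mul_one g.1))
  comp_id := by
    rintro H K ⟨g⟩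
    exact congrArg (Quotient.mk (transporterSetoid H.1 K.1)) (Subtype.ext (one_mul g.1))
  assoc := by
    rintro H K L M ⟨a⟩ ⟨b⟩ ⟨c⟩
    exact congrArg (Quotient.mk (transporterSetoid H.1 M.1))
      (Subtype.ext (mul_assoc c.1 b.1 a.1).symm)

/-- The set `N_G(K)/C_G(K)` of cosets. -/
abbrev NormalizerModCentralizer (K : Subgroup G) : Type u :=
  ↥(Subgroup.normalizer (K : Set G)) ⧸
    (Subgroup.centralizer (K : Set G)).subgroupOf (Subgroup.normalizer (K : Set G))

end Quillen

end QuillenHereditary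

namespace QuillenHereditary

/-! ### Hereditary categories -/

section HereditaryCategory

/-! Write `Q` for the Quillen category. A non-degenerate module `M` over its algebra is the direct
sum of the pieces `e_d M`, with `e_d` the identity of `d`, so left modules are functors `Q ⥤
ModuleCat k` and right modules are functors on `Qᵒᵖ`. Being hereditary thus becomes a property of
these two functor categories. Condition 1 says that the subgroups of each `K` form a chain
(`isCyclic_and_card_eq_prime_pow_iff`), and `N_G(K)/C_G(K)` is counted by the endomorphisms of `K`.

Necessity. The image of a map `φ` from a free functor to a projective one is projective, so the
source has an endomorphism `θ` with `φθ = φ` that depends only on values of `φ`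
(`IsHereditaryCategory.exists_endomorphism`). For the norm element of `Aut K` this forces `|Aut K|`
to be invertible. For incomparable `A, B ≤ K`, a map out of the sum of the free functors on `A` and
`B` identifies two elements that `θ` has to keep apart.

Sufficiency. All morphisms of `Q` are monomorphisms, all endomorphisms are invertible, and each
non-isomorphism to `K` lands in the greatest proper subgroup of `K`. A functor with injective values
is then projective: lifts are built by induction on the order of `K`, corrected along the greatest
proper subgroup and averaged over isomorphisms (`ChainStructure.lift_spec`). Projective functors and
their subfunctors have injective values, which settles the left side. On the right, the dual
statement says that contravariant functors with surjective values are injective objects; a pushout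
argument turns this into projectivity of subobjects of projectives
(`ChainStructure.isHereditaryCategory_op`). -/

theorem IsHereditaryCategory.of_equivalence {A : Type*} [Category* A] {B : Type*} [Category* B]
    (e : A ≌ B) (hB : IsHereditaryCategory B) : IsHereditaryCategory A := by
  intro P Q i hi hP
  exact (e.map_projective_iff Q).1
    (hB _ _ (e.functor.map i) inferInstance ((e.map_projective_iff P).2 hP))

theorem isHereditaryCategory_congr {A : Type*} [Category* A] {B : Type*} [Category* B]
    (e : A ≌ B) : IsHereditaryCategory A ↔ IsHereditaryCategory B :=
  ⟨.of_equivalence e.symm, .of_equivalence e⟩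

/-- In a hereditary abelian category, the epimorphism onto the image of a morphism to a projective
object splits. -/
theorem IsHereditaryCategory.exists_section_image {A : Type*} [Category* A] [Abelian A]
    (hA : IsHereditaryCategory A) {F P : A} [Projective P] (φ : F ⟶ P) :
    ∃ ψ : Limits.image φ ⟶ F, (Limits.factorThruImage φ ≫ ψ) ≫ φ = φ := by
  have := hA P (Limits.image φ) (Limits.image.ι φ) inferInstance inferInstance
  have e : Projective.factorThru (𝟙 _) (Limits.factorThruImage φ) ≫ φ = Limits.image.ι φ := by
    have := congrArg (· ≫ Limits.image.ι φ)
      (Projective.factorThru_comp (𝟙 _) (Limits.factorThruImage φ))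
    simpa only [Category.assoc, Limits.image.fac, Category.id_comp] using this
  exact ⟨_, by rw [Category.assoc, e, Limits.image.fac]⟩

end HereditaryCategory

/-! ### Free functors -/

section FreeFunctor

variable (k : Type w) [Field k] {D : Type u} [Category.{u} D]

/-- Composition with `f`, on the disjoint union of the sets `Hom(c i, -)`. -/
def push {D : Type u} [Category.{u} D] {ι : Type v} (c : ι → D) {L L' : D} (f : L ⟶ L')
    (p : Σ i, c i ⟶ L) : Σ i, c i ⟶ L' := ⟨p.1, p.2 ≫ f⟩

/-- The direct sum of the linearised representable functors `k Hom(c i, -)`. -/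
noncomputable def freeFunctor {ι : Type v} (c : ι → D) : D ⥤ ModuleCat.{max u v w} k where
  obj L := ModuleCat.of k ((Σ i, c i ⟶ L) →₀ k)
  map f := ModuleCat.ofHom (Finsupp.lmapDomain k k (push c f))
  map_id L := by
    ext p
    simp [push]
  map_comp f g := by
    ext p
    simp [push]

variable {k} {ι : Type v} (c : ι → D)

theorem freeFunctor_map {L L' : D} (f : L ⟶ L') (x : (Σ i, c i ⟶ L) →₀ k) :
    ((freeFunctor k c).map f).hom x =
      Finsupp.mapDomain (push c f) x := rfl

/-- The generator of `freeFunctor k c` with index `i`. -/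
noncomputable def freeFunctor.gen (i : ι) : (freeFunctor k c).obj (c i) :=
  Finsupp.single (⟨i, 𝟙 _⟩ : Σ j, c j ⟶ c i) (1 : k)

theorem freeFunctor_map_gen {i : ι} {L : D} (f : c i ⟶ L) :
    ((freeFunctor k c).map f).hom (freeFunctor.gen c i) =
      Finsupp.single (⟨i, f⟩ : Σ j, c j ⟶ L) (1 : k) := by
  rw [freeFunctor.gen]
  erw [freeFunctor_map]
  rw [Finsupp.mapDomain_single, push, Category.id_comp]

variable {c} {X : D ⥤ ModuleCat.{max u v w} k}

/-- The natural transformation out of a free functor given by the images of the generators. -/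
noncomputable def freeFunctor.desc (x : ∀ i, X.obj (c i)) : freeFunctor k c ⟶ X where
  app L := ModuleCat.ofHom
    (Finsupp.linearCombination k fun p : Σ i, c i ⟶ L => (X.map p.2).hom (x p.1))
  naturality L L' f := by
    ext : 1
    refine Finsupp.lhom_ext' fun p => LinearMap.ext_ring ?_
    change Finsupp.linearCombination k _ (Finsupp.mapDomain _ (Finsupp.single p 1)) =
      (X.map f).hom (Finsupp.linearCombination k _ (Finsupp.single p 1))
    rw [Finsupp.mapDomain_single, Finsupp.linearCombination_single,
      Finsupp.linearCombination_single]
    simp only [push, Functor.map_comp, ModuleCat.hom_comp, one_smul]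
    rfl

theorem freeFunctor.desc_single (x : ∀ i, X.obj (c i)) {L : D} (p : Σ i, c i ⟶ L) :
    ((freeFunctor.desc x).app L).hom (Finsupp.single p (1 : k) : (Σ i, c i ⟶ L) →₀ k) =
      (X.map p.2).hom (x p.1) := by
  change Finsupp.linearCombination k _ (Finsupp.single p 1) = _
  rw [Finsupp.linearCombination_single, one_smul]

theorem freeFunctor.desc_gen (x : ∀ i, X.obj (c i)) (i : ι) :
    ((freeFunctor.desc x).app (c i)).hom (freeFunctor.gen c i) = x i := by
  refine (freeFunctor.desc_single x _).trans ?_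
  simp

/-- Yoneda: each basis element `q : c i ⟶ L` is the image under `q` of the generator with index `i`,
so naturality fixes everything from the generators. -/
theorem freeFunctor.hom_ext {f g : freeFunctor k c ⟶ X}
    (h : ∀ i, (f.app (c i)).hom (freeFunctor.gen c i) = (g.app (c i)).hom (freeFunctor.gen c i)) :
    f = g := by
  ext L : 3
  refine Finsupp.lhom_ext' fun p => LinearMap.ext_ring ?_
  obtain ⟨i, q⟩ := p
  have key : ∀ f : freeFunctor k c ⟶ X, (f.app L).hom (Finsupp.single (⟨i, q⟩ : Σ j, c j ⟶ L) (1 : k)) =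
      (X.map q).hom ((f.app (c i)).hom (freeFunctor.gen c i)) := fun f => by
    rw [← freeFunctor_map_gen]
    exact NatTrans.naturality_apply f q _
  exact (key f).trans ((congrArg _ (h i)).trans (key g).symm)

instance freeFunctor.projective : Projective (freeFunctor k c) where
  factors {E X} f e he := by
    have hs : ∀ L, Function.Surjective (e.app L).hom := fun L =>
      (ModuleCat.epi_iff_surjective _).1 ((NatTrans.epi_iff_epi_app e).1 he L)
    choose y hy using fun i => hs (c i) ((f.app (c i)).hom (freeFunctor.gen c i))
    refine ⟨freeFunctor.desc y, freeFunctor.hom_ext fun i => ?_⟩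
    rw [← hy i, ← freeFunctor.desc_gen (k := k) y i]
    rfl

/-- In a hereditary functor category, a morphism from a free functor to a projective
has an endomorphism `θ` of its source through which it factors, vanishing on its kernel. -/
theorem IsHereditaryCategory.exists_endomorphism
    (h : IsHereditaryCategory (D ⥤ ModuleCat.{max u v w} k)) {F P : D ⥤ ModuleCat.{max u v w} k}
    [Projective P] (φ : F ⟶ P) :
    ∃ θ : F ⟶ F, (∀ L (x : F.obj L), (φ.app L).hom ((θ.app L).hom x) = (φ.app L).hom x) ∧
      ∀ L (x y : F.obj L), (φ.app L).hom x = (φ.app L).hom y →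
        (θ.app L).hom x = (θ.app L).hom y := by
  obtain ⟨ψ, hψ⟩ := h.exists_section_image φ
  refine ⟨Limits.factorThruImage φ ≫ ψ, fun L x => ?_, fun L x y hxy => ?_⟩
  · exact congrArg (fun η : F ⟶ P => (η.app L).hom x) hψ
  · have hm : Function.Injective ((Limits.image.ι φ).app L).hom :=
      (ModuleCat.mono_iff_injective _).1 ((NatTrans.mono_iff_mono_app _).1 inferInstance L)
    have hfac : ∀ z, ((Limits.image.ι φ).app L).hom (((Limits.factorThruImage φ).app L).hom z) =
        (φ.app L).hom z := fun z =>
      congrArg (fun η : F ⟶ P => (η.app L).hom z) (Limits.image.fac φ)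
    have : ((Limits.factorThruImage φ).app L).hom x = ((Limits.factorThruImage φ).app L).hom y :=
      hm (by rw [hfac, hfac, hxy])
    change (ψ.app L).hom (((Limits.factorThruImage φ).app L).hom x) = _
    rw [this]
    rfl

/-- `IsHereditaryCategory.exists_endomorphism` for a morphism between free functors. -/
theorem IsHereditaryCategory.exists_linearMap
    (h : IsHereditaryCategory (D ⥤ ModuleCat.{max u v w} k)) {ι κ : Type v} (c : ι → D) (d : κ → D)
    (y : ∀ i, (Σ j, d j ⟶ c i) →₀ k) :
    ∃ θ : ∀ L, ((Σ i, c i ⟶ L) →₀ k) →ₗ[k] ((Σ i, c i ⟶ L) →₀ k),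
      (∀ (L L' : D) (f : L ⟶ L') x,
        θ L' (Finsupp.mapDomain (push c f) x) = Finsupp.mapDomain (push c f) (θ L x)) ∧
      (∀ L x, Finsupp.linearCombination k
          (fun p : Σ i, c i ⟶ L => Finsupp.mapDomain (push d p.2) (y p.1)) (θ L x) =
        Finsupp.linearCombination k
          (fun p : Σ i, c i ⟶ L => Finsupp.mapDomain (push d p.2) (y p.1)) x) ∧
      ∀ L x x', Finsupp.linearCombination k
          (fun p : Σ i, c i ⟶ L => Finsupp.mapDomain (push d p.2) (y p.1)) x =
        Finsupp.linearCombination k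
          (fun p : Σ i, c i ⟶ L => Finsupp.mapDomain (push d p.2) (y p.1)) x' →
        θ L x = θ L x' := by
  obtain ⟨θ, h₁, h₂⟩ := IsHereditaryCategory.exists_endomorphism.{u, v} h
    (freeFunctor.desc (c := c) (X := freeFunctor k d) y)
  exact ⟨fun L => (θ.app L).hom, fun L L' f x => NatTrans.naturality_apply θ f x, h₁, h₂⟩

/-- If the category of functors is hereditary, finite automorphism groups have invertible order. -/
theorem IsHereditaryCategory.isUnit_card_end (h : IsHereditaryCategory (D ⥤ ModuleCat.{max u w} k))
    (K : D) [Finite (K ⟶ K)] (hK : ∀ f : K ⟶ K, IsIso f) :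
    IsUnit ((Nat.card (K ⟶ K) : ℕ) : k) := by
  classical
  have := Fintype.ofFinite (K ⟶ K)
  -- Source and target are both `k Hom(K, -)`, and `φ` sends the generator to the norm element `N`,
  -- the sum of all endomorphisms of `K`.
  let c : PUnit.{1} → D := fun _ => K
  let b : (K ⟶ K) → ((Σ i, c i ⟶ K) →₀ k) := fun f => Finsupp.single ⟨PUnit.unit, f⟩ 1
  let N : (Σ i, c i ⟶ K) →₀ k := ∑ f : K ⟶ K, b f
  have hN1 : ∀ f : K ⟶ K, N ⟨PUnit.unit, f⟩ = 1 := fun f => by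
    simp [N, b, Finsupp.coe_finsetSum, Finset.sum_apply, Finsupp.single_apply]
  have hb : ∀ f g : K ⟶ K, Finsupp.mapDomain (push c g) (b f) = b (f ≫ g) := fun f g =>
    Finsupp.mapDomain_single
  have hN : ∀ g : K ⟶ K, Finsupp.mapDomain (push c g) N = N := fun g => by
    have := hK g
    simp only [N, Finsupp.mapDomain_finsetSum, hb]
    exact Fintype.sum_bijective (fun f => f ≫ g)
      ⟨fun f f' hf => (cancel_mono g).1 hf, fun f => ⟨f ≫ inv g, by simp⟩⟩ _ _ fun _ => rfl
  obtain ⟨θ, h₀, h₁, h₂⟩ := IsHereditaryCategory.exists_linearMap.{u, 0} h c c fun _ => N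
  set φ := Finsupp.linearCombination k
    (fun p : Σ i, c i ⟶ K => Finsupp.mapDomain (push c p.2) N) with hφdef
  have hφ : ∀ f, φ (b f) = N := fun f => by
    rw [hφdef, Finsupp.linearCombination_single, one_smul, hN]
  -- All basis elements have the same image `N` under `φ`, hence the same image under `θ`. So `θ(1)`
  -- is invariant under `Aut K` and has constant coefficients: it is a multiple of `N`.
  have hx : ∀ f, θ K (b (𝟙 K)) ⟨PUnit.unit, f⟩ = θ K (b (𝟙 K)) ⟨PUnit.unit, 𝟙 K⟩ := fun f => by
    have e : Finsupp.mapDomain (push c f) (θ K (b (𝟙 K))) = θ K (b (𝟙 K)) := by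
      rw [← h₀, hb]
      exact h₂ K _ _ ((hφ _).trans (hφ _).symm)
    have := hK f
    have e' := DFunLike.congr_fun e (push c f ⟨PUnit.unit, 𝟙 K⟩)
    rw [Finsupp.mapDomain_apply (by
        rintro ⟨_, p⟩ ⟨_, q⟩ hpq
        simpa [push, cancel_mono] using hpq)] at e'
    rw [e', push, Category.id_comp]
  have hxs : θ K (b (𝟙 K)) = θ K (b (𝟙 K)) ⟨PUnit.unit, 𝟙 K⟩ • N := by
    ext ⟨_, f⟩
    rw [hx f, Finsupp.smul_apply, hN1, smul_eq_mul, mul_one]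
  have hφN : φ N = (Nat.card (K ⟶ K) : k) • N := by
    simp only [N, map_sum]
    simp [hφ, Nat.cast_smul_eq_nsmul, N]
  -- With `θ(1) = r N` and `φ(N) = |Aut K| N`, this reads `r |Aut K| N = N`, so `r` is the inverse
  -- sought.
  have e : φ (θ K (b (𝟙 K))) = N := (h₁ K _).trans (hφ _)
  rw [hxs, map_smul, hφN] at e
  have e3 := DFunLike.congr_fun e ⟨PUnit.unit, 𝟙 K⟩
  rw [Finsupp.smul_apply, Finsupp.smul_apply, hN1, smul_eq_mul, smul_eq_mul, mul_one] at e3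
  exact IsUnit.of_mul_eq_one_right _ e3

end FreeFunctor

/-! ### The Quillen category -/

section Quillen

variable {G : Type u} [Group G]

namespace QuillenHom

variable {H K L : Subgroup G}

/-- The homomorphism `H → K` of conjugation by `g`, as a map, for the class of `g`. -/
def val (f : QuillenHom H K) : H → K :=
  Quotient.lift (s := transporterSetoid H K)
    (fun (g : Transporter H K) (h : H) => (⟨g.1 * h * g.1⁻¹, g.2 h h.2⟩ : K))
    (by
      rintro ⟨a, ha⟩ ⟨b, hb⟩ (hab : a⁻¹ * b ∈ Subgroup.centralizer (H : Set G))
      funext h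
      have := Subgroup.mem_centralizer_iff.1 hab h h.2
      refine Subtype.ext (?_ : a * h * a⁻¹ = b * h * b⁻¹)
      calc a * h * a⁻¹ = a * (h * (a⁻¹ * b)) * b⁻¹ := by group
        _ = a * ((a⁻¹ * b) * h) * b⁻¹ := by rw [this]
        _ = b * h * b⁻¹ := by group) f

theorem val_mk (g : Transporter H K) (h : H) :
    (val (Quotient.mk (transporterSetoid H K) g) h : G) = g.1 * h * g.1⁻¹ := rfl

/-- Two elements of `G` conjugate `H` in the same way exactly when they differ by `C_G(H)` on the
right. Morphisms are therefore injective maps between finite sets, which yields finite Hom sets,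
cancellation and invertible endomorphisms. -/
theorem ext_val {f f' : QuillenHom H K} (h : f.val = f'.val) : f = f' := by
  induction f using Quotient.inductionOn with | _ a
  induction f' using Quotient.inductionOn with | _ b
  refine Quotient.sound (s := transporterSetoid H K)
    (?_ : a.1⁻¹ * b.1 ∈ Subgroup.centralizer (H : Set G))
  rw [Subgroup.mem_centralizer_iff]
  intro x hx
  have e : a.1 * x * a.1⁻¹ = b.1 * x * b.1⁻¹ := congrArg Subtype.val (congrFun h ⟨x, hx⟩)
  calc x * (a.1⁻¹ * b.1) = a.1⁻¹ * (a.1 * x * a.1⁻¹) * b.1 := by group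
    _ = a.1⁻¹ * (b.1 * x * b.1⁻¹) * b.1 := by rw [e]
    _ = a.1⁻¹ * b.1 * x := by group

theorem val_comp (f : QuillenHom H K) (f' : QuillenHom K L) (h : H) :
    (f.comp f').val h = f'.val (f.val h) := by
  induction f using Quotient.inductionOn with | _ a
  induction f' using Quotient.inductionOn with | _ b
  refine Subtype.ext (?_ : (b.1 * a.1) * h * (b.1 * a.1)⁻¹ = b.1 * (a.1 * h * a.1⁻¹) * b.1⁻¹)
  group

theorem val_id (h : H) : (QuillenHom.id H).val h = h :=
  Subtype.ext (show 1 * (h : G) * 1⁻¹ = h by group)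

theorem val_injective (f : QuillenHom H K) : Function.Injective f.val := by
  induction f using Quotient.inductionOn with | _ a
  intro h h' e
  have e' : a.1 * h * a.1⁻¹ = a.1 * h' * a.1⁻¹ := congrArg Subtype.val e
  exact Subtype.ext (by simpa using e')

/-- If the image of `f : H → K` lies in `K'`, then `f` is induced by an element of
`Trans_G(H, K')`. -/
theorem exists_of_val_mem (f : QuillenHom H K) (hL : ∀ h, (f.val h : G) ∈ L) :
    ∃ f' : QuillenHom H L, ∀ h, (f'.val h : G) = f.val h := by
  induction f using Quotient.inductionOn with | _ a
  exact ⟨Quotient.mk (transporterSetoid H L) ⟨a.1, fun h hh => hL ⟨h, hh⟩⟩, fun h => rfl⟩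

/-- The image of `f` is a subgroup. -/
theorem exists_range (f : QuillenHom H K) :
    ∃ A : Subgroup G, ∀ a, a ∈ A ↔ ∃ h, (f.val h : G) = a := by
  induction f using Quotient.inductionOn with | _ a
  refine ⟨H.map (MulAut.conj a.1).toMonoidHom, fun x => ?_⟩
  exact ⟨fun ⟨h, hh, e⟩ => ⟨⟨h, hh⟩, e⟩, fun ⟨h, e⟩ => ⟨h, h.2, e⟩⟩

theorem exists_inverse (f : QuillenHom H K) (hf : Function.Surjective f.val) :
    ∃ f' : QuillenHom K H, ∀ h, f'.val (f.val h) = h := by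
  induction f using Quotient.inductionOn with | _ a
  refine ⟨Quotient.mk (transporterSetoid K H) ⟨a.1⁻¹, fun x hx => ?_⟩, fun h => Subtype.ext ?_⟩
  · obtain ⟨h, hh⟩ := hf ⟨x, hx⟩
    have e : a.1 * h * a.1⁻¹ = x := congrArg Subtype.val hh
    rw [← e]
    convert h.2 using 1
    group
  · change a.1⁻¹ * (a.1 * h * a.1⁻¹) * a.1⁻¹⁻¹ = h
    group

/-- The morphism given by an inclusion of subgroups. -/
def incl (h : H ≤ K) : QuillenHom H K :=
  Quotient.mk (transporterSetoid H K) ⟨1, fun x hx => by simpa using h hx⟩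

theorem val_incl (h : H ≤ K) (x : H) : ((incl h).val x : G) = x :=
  show 1 * (x : G) * 1⁻¹ = x by group

end QuillenHom

namespace QuillenCategory

variable {F : FiniteSubgroupFamily G}

instance (K : QuillenCategory F) : Finite K.1 := F.finite K.1 K.2

instance (H K : QuillenCategory F) : Finite (H ⟶ K) :=
  Finite.of_injective (fun f : H ⟶ K => QuillenHom.val f) fun _ _ h => QuillenHom.ext_val h

instance (H K : QuillenCategory F) (f : H ⟶ K) : Mono f where
  right_cancellation g h e := QuillenHom.ext_val <| funext fun x =>
    QuillenHom.val_injective f <| by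
      rw [← QuillenHom.val_comp, ← QuillenHom.val_comp]
      exact congrArg (fun q => QuillenHom.val q x) e

theorem isIso_of_surjective {H K : QuillenCategory F} (f : H ⟶ K)
    (hf : Function.Surjective (QuillenHom.val f)) : IsIso f := by
  obtain ⟨f', hf'⟩ := QuillenHom.exists_inverse f hf
  refine ⟨f', QuillenHom.ext_val (funext fun x => ?_), QuillenHom.ext_val (funext fun x => ?_)⟩
  · exact (QuillenHom.val_comp _ _ _).trans ((hf' x).trans (QuillenHom.val_id x).symm)
  · obtain ⟨y, rfl⟩ := hf x
    exact (QuillenHom.val_comp _ _ _).trans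
      ((congrArg _ (hf' y)).trans (QuillenHom.val_id _).symm)

theorem isIso_end {K : QuillenCategory F} (f : K ⟶ K) : IsIso f :=
  isIso_of_surjective f (Finite.surjective_of_injective (QuillenHom.val_injective f))

theorem card_le {H K : QuillenCategory F} (f : H ⟶ K) : Nat.card H.1 ≤ Nat.card K.1 :=
  Nat.card_le_card_of_injective _ (QuillenHom.val_injective f)

/-- `N_G(K)/C_G(K)` is in bijection with the endomorphisms of `K`. -/
theorem card_normalizerModCentralizer (K : QuillenCategory F) :
    Nat.card (NormalizerModCentralizer K.1) = Nat.card (K ⟶ K) := by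
  have hmem : ∀ g : G, g ∈ Subgroup.normalizer (K.1 : Set G) ↔ ∀ h ∈ K.1, g * h * g⁻¹ ∈ K.1 := by
    intro g
    rw [Subgroup.mem_normalizer_iff]
    -- Since `K` is finite, `gKg⁻¹ ⊆ K` already forces equality.
    refine ⟨fun h x hx => (h x).1 hx, fun h x => ⟨h x, fun hx => ?_⟩⟩
    obtain ⟨y, hy⟩ := Finite.surjective_of_injective
      (QuillenHom.val_injective (Quotient.mk (transporterSetoid K.1 K.1) ⟨g, h⟩)) ⟨_, hx⟩
    have e : g * y * g⁻¹ = g * x * g⁻¹ := congrArg Subtype.val hy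
    have e' : (y : G) = x := by simpa using e
    exact e' ▸ y.2
  let e : ↥(Subgroup.normalizer (K.1 : Set G)) ≃ Transporter K.1 K.1 :=
    Equiv.subtypeEquivRight hmem
  refine Nat.card_congr (Quotient.congr e fun a b => ?_)
  exact QuotientGroup.leftRel_apply

/-- The inclusion of a subgroup, as a morphism of the Quillen category. -/
def incl {H K : QuillenCategory F} (h : H.1 ≤ K.1) : H ⟶ K := QuillenHom.incl h

theorem val_incl {H K : QuillenCategory F} (h : H.1 ≤ K.1) (x : H.1) :
    (QuillenHom.val (incl h) x : G) = x := QuillenHom.val_incl h x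

theorem val_comp {H K L : QuillenCategory F} (f : H ⟶ K) (g : K ⟶ L) (x : H.1) :
    QuillenHom.val (f ≫ g) x = QuillenHom.val g (QuillenHom.val f x) :=
  QuillenHom.val_comp f g x

theorem exists_comp_incl {H K K' : QuillenCategory F} (h : K'.1 ≤ K.1) (f : H ⟶ K)
    (hf : ∀ x, (QuillenHom.val f x : G) ∈ K'.1) : ∃ g : H ⟶ K', g ≫ incl h = f := by
  obtain ⟨g, hg⟩ := QuillenHom.exists_of_val_mem f hf
  exact ⟨g, QuillenHom.ext_val <| funext fun x => Subtype.ext <|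
    (congrArg Subtype.val (val_comp g (incl h) x)).trans ((val_incl h _).trans (hg x))⟩

end QuillenCategory

/-! ### Groups whose subgroups form a chain -/

theorem isCyclic_and_card_eq_prime_pow_of_total {K : Type*} [Group K] [Finite K]
    (h : ∀ A B : Subgroup K, A ≤ B ∨ B ≤ A) :
    IsCyclic K ∧ ∃ p n : ℕ, p.Prime ∧ Nat.card K = p ^ n := by
  constructor
  -- In a chain, a cyclic subgroup of maximal order contains every other cyclic subgroup.
  · obtain ⟨g, hg⟩ := Finite.exists_max fun g : K => Nat.card (Subgroup.zpowers g)
    refine ⟨g, fun x => ?_⟩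
    rcases h (Subgroup.zpowers x) (Subgroup.zpowers g) with hx | hx
    · exact hx (Subgroup.mem_zpowers x)
    · exact (Subgroup.eq_of_le_of_card_ge hx (hg x)).ge (Subgroup.mem_zpowers x)
  · rcases eq_or_ne (Nat.card K) 1 with h1 | h1
    -- For the trivial group any prime would serve, with exponent `0`.
    · exact ⟨2, 0, Nat.prime_two, by simpa using h1⟩
    · refine ⟨_, _, Nat.minFac_prime h1, Nat.eq_prime_pow_of_unique_prime_dvd Nat.card_pos.ne' ?_⟩
      intro q hq hqd
      have := Fact.mk hq
      have := Fact.mk (Nat.minFac_prime h1)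
      -- By Cauchy, two prime divisors give subgroups of these two orders; comparability makes one
      -- prime divide the other.
      obtain ⟨x, hx⟩ := exists_prime_orderOf_dvd_card' q hqd
      obtain ⟨y, hy⟩ := exists_prime_orderOf_dvd_card' _ (Nat.minFac_dvd (Nat.card K))
      rcases h (Subgroup.zpowers x) (Subgroup.zpowers y) with hxy | hxy
      · have := Subgroup.card_dvd_of_le hxy
        rw [Nat.card_zpowers, Nat.card_zpowers, hx, hy] at this
        exact (Nat.prime_dvd_prime_iff_eq hq (Nat.minFac_prime h1)).1 this
      · have := Subgroup.card_dvd_of_le hxy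
        rw [Nat.card_zpowers, Nat.card_zpowers, hx, hy] at this
        exact ((Nat.prime_dvd_prime_iff_eq (Nat.minFac_prime h1) hq).1 this).symm

theorem total_of_isCyclic {K : Type*} [Group K] [Finite K] [IsCyclic K] {p n : ℕ} (hp : p.Prime)
    (hK : Nat.card K = p ^ n) (A B : Subgroup K) : A ≤ B ∨ B ≤ A := by
  classical
  have := Fintype.ofFinite K
  -- A cyclic group has at most `|B|` solutions of `a ^ |B| = 1`, so `B` consists of all of them,
  -- and `A` is among them.
  have key : ∀ A B : Subgroup K, Nat.card A ∣ Nat.card B → A ≤ B := fun A B hAB => by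
    let S : Finset K := Finset.univ.filter fun a => a ^ Nat.card B = 1
    have hBS : (B : Set K).toFinset ⊆ S := fun b hb => by
      simp only [S, Finset.mem_filter, Finset.mem_univ, true_and]
      exact orderOf_dvd_iff_pow_eq_one.1 (B.orderOf_dvd_natCard (by simpa using hb))
    have hS : S = (B : Set K).toFinset := (Finset.eq_of_subset_of_card_le hBS (by
      refine (IsCyclic.card_pow_eq_one_le Nat.card_pos).trans ?_
      rw [Set.toFinset_card, ← Nat.card_eq_fintype_card]
      rfl)).symm
    intro a ha
    have : a ∈ S := by
      simp only [S, Finset.mem_filter, Finset.mem_univ, true_and]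
      obtain ⟨c, hc⟩ := hAB
      rw [hc, pow_mul, orderOf_dvd_iff_pow_eq_one.1 (A.orderOf_dvd_natCard ha), one_pow]
    rw [hS] at this
    simpa using this
  obtain ⟨a, -, ha⟩ := (Nat.dvd_prime_pow hp).1 (hK ▸ A.card_subgroup_dvd_card)
  obtain ⟨b, -, hb⟩ := (Nat.dvd_prime_pow hp).1 (hK ▸ B.card_subgroup_dvd_card)
  rcases le_total a b with hab | hab
  · exact .inl (key _ _ (by rw [ha, hb]; exact pow_dvd_pow p hab))
  · exact .inr (key _ _ (by rw [ha, hb]; exact pow_dvd_pow p hab))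

/-- A subgroup is cyclic of prime power order if and only if its subgroups form a chain. -/
theorem isCyclic_and_card_eq_prime_pow_iff (K : Subgroup G) [Finite K] :
    (IsCyclic K ∧ ∃ p n : ℕ, p.Prime ∧ Nat.card K = p ^ n) ↔
      ∀ A B : Subgroup G, A ≤ K → B ≤ K → A ≤ B ∨ B ≤ A := by
  constructor
  · rintro ⟨_, p, n, hp, hn⟩ A B hA hB
    rcases total_of_isCyclic hp hn (A.subgroupOf K) (B.subgroupOf K) with h | h
    · exact .inl fun a ha => h (show (⟨a, hA ha⟩ : K) ∈ A.subgroupOf K from ha)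
    · exact .inr fun a ha => h (show (⟨a, hB ha⟩ : K) ∈ B.subgroupOf K from ha)
  · intro h
    refine isCyclic_and_card_eq_prime_pow_of_total fun A B => ?_
    rcases h _ _ (Subgroup.map_subtype_le A) (Subgroup.map_subtype_le B) with h | h
    · exact .inl ((Subgroup.map_le_map_iff_of_injective K.subtype_injective).1 h)
    · exact .inr ((Subgroup.map_le_map_iff_of_injective K.subtype_injective).1 h)

end Quillen

/-! ### Necessity -/

section Necessity

variable {k : Type w} [Field k] {G : Type u} [Group G] {F : FiniteSubgroupFamily G}

/-- For incomparable `A` and `B`, map the sum of the free functors on `A` and `B` to the free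
functor on the trivial group `T`. As `Hom(T, K)` is a single point, the inclusions of `A` and `B` in
`K` get the same image. -/
theorem total_of_isHereditaryCategory
    (h : IsHereditaryCategory (QuillenCategory F ⥤ ModuleCat.{max u w} k))
    {K A B : Subgroup G} (hK : K ∈ F.carrier) (hA : A ≤ K) (hB : B ≤ K) : A ≤ B ∨ B ≤ A := by
  classical
  by_contra! hAB
  let K' : QuillenCategory F := ⟨K, hK⟩
  let T : QuillenCategory F := ⟨⊥, F.subgroup_mem K hK ⊥ bot_le⟩
  have hT : ∀ L : QuillenCategory F, Subsingleton (T ⟶ L) := fun L =>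
    ⟨fun f g => QuillenHom.ext_val <| funext fun x => Subtype.ext <| by
      obtain rfl : x = 1 := Subsingleton.elim _ _
      induction f using Quotient.inductionOn with | _ a
      induction g using Quotient.inductionOn with | _ b
      simp [QuillenHom.val_mk]⟩
  let c : Bool → QuillenCategory F := fun i =>
    if i then ⟨A, F.subgroup_mem K hK A hA⟩ else ⟨B, F.subgroup_mem K hK B hB⟩
  let d : Bool → QuillenCategory F := fun _ => T
  have hc : ∀ i, (c i).1 ≤ K := by
    rintro (_ | _)
    exacts [hB, hA]
  let ι : ∀ i, c i ⟶ K' := fun i => QuillenCategory.incl (hc i)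
  obtain ⟨θ, h₀, h₁, h₂⟩ := IsHereditaryCategory.exists_linearMap.{u, 0} h c d
    fun i => Finsupp.single ⟨true, QuillenCategory.incl bot_le⟩ 1
  let g : ∀ i, (Σ j, c j ⟶ K') →₀ k := fun i => Finsupp.single ⟨i, ι i⟩ 1
  have hg : ∀ i, g i = Finsupp.mapDomain (push c (ι i)) (Finsupp.single ⟨i, 𝟙 _⟩ 1) := fun i => by
    rw [Finsupp.mapDomain_single, push, Category.id_comp]
  have e : θ K' (g true) = θ K' (g false) := by
    refine h₂ K' _ _ ?_
    simp only [g, Finsupp.linearCombination_single, Finsupp.mapDomain_single, push]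
    congr 3
  have hne : θ K' (g true) ≠ 0 := fun h0 => by
    have := h₁ K' (g true)
    rw [h0, map_zero] at this
    simp only [g, Finsupp.linearCombination_single, Finsupp.mapDomain_single, one_smul] at this
    exact one_ne_zero (Finsupp.single_eq_zero.1 this.symm)
  obtain ⟨⟨j, q⟩, hq⟩ := Finsupp.support_nonempty_iff.2 hne
  -- By naturality `θ(ι i)` is pushed forward along `ι i`, so each `q` in its support has image in
  -- `c i`. The two values of `θ` agree, so the image of `q` lies in `A ∩ B`.
  have hq' : ∀ i, ∀ x, (QuillenHom.val q x : G) ∈ (c i).1 := fun i x => by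
    have hqi : (⟨j, q⟩ : Σ j, c j ⟶ K') ∈ (θ K' (g i)).support := by
      cases i
      exacts [e ▸ hq, hq]
    rw [hg, h₀] at hqi
    obtain ⟨⟨j', p⟩, -, hp⟩ := Finset.mem_image.1 (Finsupp.mapDomain_support hqi)
    obtain ⟨rfl, hp⟩ := Sigma.mk.inj_iff.1 hp
    obtain rfl := eq_of_heq hp
    rw [QuillenCategory.val_comp, QuillenCategory.val_incl]
    exact SetLike.coe_mem _
  -- `q` embeds `c j` in `c j ⊓ c i`; comparing orders gives the inclusion.
  have hle : ∀ i, (c j).1 ≤ (c i).1 := fun i => by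
    obtain ⟨f, hf⟩ := QuillenHom.exists_of_val_mem q (L := (c j).1 ⊓ (c i).1)
      fun x => ⟨hq' j x, hq' i x⟩
    have : Nat.card (c j).1 ≤ Nat.card ((c j).1 ⊓ (c i).1 : Subgroup G) :=
      have : Finite ((c j).1 ⊓ (c i).1 : Subgroup G) :=
        F.finite _ (F.subgroup_mem _ (c j).2 _ inf_le_left)
      Nat.card_le_card_of_injective _ f.val_injective
    exact inf_eq_left.1 (Subgroup.eq_of_le_of_card_ge inf_le_left this)
  cases j
  · exact hAB.2 (hle true)
  · exact hAB.1 (hle false)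

/-- Here `φ` maps the sum of `k Hom(-, A)` and `k Hom(-, B)` to `k Hom(-, K)`. It is injective at
`A` and at `B`, so `θ` fixes both generators, but their restrictions to `A ⊓ B` have the same image
under `φ` while lying in different summands. -/
theorem total_of_isHereditaryCategory_op
    (h : IsHereditaryCategory ((QuillenCategory F)ᵒᵖ ⥤ ModuleCat.{max u w} k))
    {K A B : Subgroup G} (hK : K ∈ F.carrier) (hA : A ≤ K) (hB : B ≤ K) : A ≤ B ∨ B ≤ A := by
  classical
  by_contra! hAB
  let K' : QuillenCategory F := ⟨K, hK⟩
  let c' : Bool → QuillenCategory F := fun i =>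
    if i then ⟨A, F.subgroup_mem K hK A hA⟩ else ⟨B, F.subgroup_mem K hK B hB⟩
  let T : QuillenCategory F := ⟨A ⊓ B, F.subgroup_mem K hK _ (inf_le_left.trans hA)⟩
  let c : Bool → (QuillenCategory F)ᵒᵖ := fun i => .op (c' i)
  let d : Bool → (QuillenCategory F)ᵒᵖ := fun _ => .op K'
  have hc : ∀ i, (c' i).1 ≤ K := by
    rintro (_ | _)
    exacts [hB, hA]
  have hTc : ∀ i, T.1 ≤ (c' i).1 := by
    rintro (_ | _)
    exacts [inf_le_right, inf_le_left]
  have hcc : ∀ i j, (c' i).1 ≤ (c' j).1 → i = j := by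
    rintro (_ | _) (_ | _) hij
    exacts [rfl, (hAB.2 hij).elim, (hAB.1 hij).elim, rfl]
  let ι : ∀ i, c' i ⟶ K' := fun i => QuillenCategory.incl (hc i)
  obtain ⟨θ, h₀, h₁, h₂⟩ := IsHereditaryCategory.exists_linearMap.{u, 0} h c d
    fun i => Finsupp.single ⟨true, (ι i).op⟩ 1
  let g : ∀ i, (Σ j, c j ⟶ c i) →₀ k := fun i => Finsupp.single ⟨i, 𝟙 _⟩ 1
  have hφ : ∀ L x, Finsupp.linearCombination k (fun p : Σ i, c i ⟶ L =>
        Finsupp.mapDomain (push d p.2) (Finsupp.single (⟨true, (ι p.1).op⟩ : Σ j, d j ⟶ c p.1) 1)) x =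
      Finsupp.mapDomain (fun p : Σ i, c i ⟶ L => (⟨true, (ι p.1).op ≫ p.2⟩ : Σ i, d i ⟶ L))
        x := fun L x => by
    induction x using Finsupp.induction_linear with
    | zero => simp
    | add x y hx hy => rw [map_add, hx, hy, Finsupp.mapDomain_add]
    | single p a =>
      simp only [Finsupp.linearCombination_single, Finsupp.mapDomain_single, push]
      simp
  simp only [hφ] at h₁ h₂
  have hθ : ∀ i, θ (c i) (g i) = g i := fun i => by
    refine Finsupp.mapDomain_injective ?_ (h₁ (c i) (g i))
    rintro ⟨j, p⟩ ⟨j', p'⟩ hp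
    have hp : (ι j).op ≫ p = (ι j').op ≫ p' := eq_of_heq (Sigma.mk.inj_iff.1 hp).2
    have hp : p.unop ≫ ι j = p'.unop ≫ ι j' := congrArg Quiver.Hom.unop hp
    have hv : ∀ x, (QuillenHom.val p.unop x : G) = QuillenHom.val p'.unop x := fun x => by
      have := congrArg (fun q : c' i ⟶ K' => (QuillenHom.val q x : G)) hp
      simpa only [QuillenCategory.val_comp, ι, QuillenCategory.val_incl] using this
    -- Otherwise `c' i` embeds in the intersection `A ⊓ B`, which it also contains; being equal to
    -- it, `c' i` would lie in both `A` and `B`, against incomparability.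
    have hjj : j = j' := by
      by_contra hjj
      obtain ⟨f, -⟩ := QuillenHom.exists_of_val_mem p.unop (L := (c' j).1 ⊓ (c' j').1)
        fun x => ⟨SetLike.coe_mem _, hv x ▸ SetLike.coe_mem _⟩
      have hle : (c' j).1 ⊓ (c' j').1 ≤ (c' i).1 := by
        rcases eq_or_ne i j with rfl | hij
        · exact inf_le_left
        · obtain rfl : i = j' := by
            cases i <;> cases j <;> cases j' <;> simp_all
          exact inf_le_right
      have : Finite ((c' j).1 ⊓ (c' j').1 : Subgroup G) :=
        F.finite _ (F.subgroup_mem _ (c' j).2 _ inf_le_left)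
      have hi := Subgroup.eq_of_le_of_card_ge hle
        (Nat.card_le_card_of_injective _ f.val_injective)
      exact hjj ((hcc i j (hi ▸ inf_le_left)).symm.trans (hcc i j' (hi ▸ inf_le_right)))
    subst hjj
    have : p.unop = p'.unop := QuillenHom.ext_val (funext fun x => Subtype.ext (hv x))
    rw [Quiver.Hom.unop_inj this]
  have hT : Finsupp.mapDomain (push c (QuillenCategory.incl (hTc true)).op) (g true) =
      Finsupp.mapDomain (push c (QuillenCategory.incl (hTc false)).op) (g false) := by
    rw [← hθ true, ← hθ false, ← h₀, ← h₀]
    refine h₂ _ _ _ ?_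
    simp only [g, Finsupp.mapDomain_single, push]
    congr 2
  simp only [g, Finsupp.mapDomain_single, push] at hT
  have := (Finsupp.single_eq_single_iff _ _ _ _).1 hT
  simp at this

end Necessity

/-! ### Lifting natural transformations along chains of subobjects -/

section Lifting

/-- Every object `K` is either minimal, or has a morphism `sub K ⟶ K` from an object of smaller rank
through which all non-isomorphisms to `K` factor. -/
structure ChainStructure (C : Type*) [Category* C] where
  rank : C → ℕ
  rank_le : ∀ {H K : C}, (H ⟶ K) → rank H ≤ rank K
  sub : C → C
  ι : ∀ K, sub K ⟶ K
  minimal_or : ∀ K, (∀ H (f : H ⟶ K), IsIso f) ∨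
    (rank (sub K) < rank K ∧ ∀ H (f : H ⟶ K), IsIso f ∨ ∃ g, g ≫ ι K = f)

variable {k : Type*} [Field k] {C : Type*} [Category* C]

/-- A chosen representative of the isomorphism class of an object. -/
noncomputable def isoRep (K : C) : C := Quotient.out (Quotient.mk (isIsomorphicSetoid C) K)

theorem nonempty_iso_isoRep (K : C) : Nonempty (K ≅ isoRep K) :=
  Quotient.exact (s := isIsomorphicSetoid C) (Quotient.out_eq _).symm

theorem isoRep_eq {K L : C} (e : K ≅ L) : isoRep K = isoRep L :=
  congrArg Quotient.out (Quotient.sound (s := isIsomorphicSetoid C) ⟨e⟩)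

/-- The isomorphisms `K ≅ R` form a torsor under `Aut K`, which is all of `End K` here. -/
theorem isUnit_card_iso (hk : ∀ K : C, IsUnit ((Nat.card (K ⟶ K) : ℕ) : k))
    (hend : ∀ (K : C) (f : K ⟶ K), IsIso f) {K R : C} (e : K ≅ R) :
    IsUnit ((Nat.card (K ≅ R) : ℕ) : k) := by
  have : (K ≅ R) ≃ (K ⟶ K) :=
    ⟨fun u => u.hom ≫ e.inv, fun f => (have := hend K f; asIso f) ≪≫ e,
      fun u => by ext; simp, fun f => by simp⟩
  rw [Nat.card_congr this]
  exact hk K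

variable [∀ H K : C, Finite (H ⟶ K)]

instance (K R : C) : Finite (K ≅ R) :=
  Finite.of_injective (fun u => u.hom) fun _ _ h => Iso.ext h

variable (k) {A : Type*} [Category* A] [Preadditive A] [Linear k A] {M X Y : C ⥤ A}

open Classical in
/-- The average of the conjugates of `a` under all isomorphisms `K ≅ R`. -/
noncomputable def isoAverage (K : C) {R : C} (a : M.obj R ⟶ X.obj R) : M.obj K ⟶ X.obj K :=
  letI := Fintype.ofFinite (K ≅ R)
  ((Nat.card (K ≅ R) : ℕ) : k)⁻¹ • ∑ u : K ≅ R, M.map u.hom ≫ a ≫ X.map u.inv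

theorem map_hom_comp_isoAverage {K L R : C} (v : K ≅ L) (a : M.obj R ⟶ X.obj R) :
    M.map v.hom ≫ isoAverage k L a = isoAverage k K a ≫ X.map v.hom := by
  classical
  let e : (L ≅ R) ≃ (K ≅ R) := ⟨fun u => v ≪≫ u, fun u => v.symm ≪≫ u, fun u => by simp,
    fun u => by simp⟩
  rw [isoAverage, isoAverage, Linear.comp_smul, Linear.smul_comp, Nat.card_congr e,
    Preadditive.comp_sum, Preadditive.sum_comp]
  congr 1
  let := Fintype.ofFinite (K ≅ R)
  let := Fintype.ofFinite (L ≅ R)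
  refine Fintype.sum_equiv e _ _ fun u => ?_
  simp [e]

variable {k}

/-- An identity satisfied by every conjugate of `a` passes to the average because the number of
conjugates is invertible; this is where condition 2 enters. -/
theorem comp_isoAverage_comp {K R : C} (hK : IsUnit ((Nat.card (K ≅ R) : ℕ) : k))
    (a : M.obj R ⟶ X.obj R) {Z Z' : A} (b : Z ⟶ M.obj K) (b' : X.obj K ⟶ Z') (c : Z ⟶ Z')
    (h : ∀ u : K ≅ R, b ≫ (M.map u.hom ≫ a ≫ X.map u.inv) ≫ b' = c) :
    b ≫ isoAverage k K a ≫ b' = c := by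
  classical
  let := Fintype.ofFinite (K ≅ R)
  rw [isoAverage, Linear.smul_comp, Linear.comp_smul, Preadditive.sum_comp, Preadditive.comp_sum]
  simp only [h]
  rw [Finset.sum_const, Finset.card_univ, ← Nat.card_eq_fintype_card, ← Nat.cast_smul_eq_nsmul k,
    smul_smul, inv_mul_cancel₀ hK.ne_zero, one_smul]

variable (k)

open Classical in
/-- The recursive construction of a lift of `φ` through `π`, given sections `s` of `π` and
retractions `ρ` of the values of `M`. -/
noncomputable def ChainStructure.lift (S : ChainStructure C) (φ : M ⟶ Y)
    (s : ∀ K, Y.obj K ⟶ X.obj K) (ρ : ∀ K, M.obj K ⟶ M.obj (S.sub K)) (K : C) :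
    M.obj K ⟶ X.obj K :=
  -- Working on one representative per isomorphism class makes the averages compatible with
  -- isomorphisms between different objects.
  isoAverage k K (R := isoRep K)
    (if _h : S.rank (S.sub (isoRep K)) < S.rank (isoRep K) then
      -- The pointwise lift `φ s` need not agree with the lift on the subobject. The correction term
      -- makes them agree along `ι`, since `ρ` retracts `M(ι)`, and it vanishes after `π`.
      φ.app _ ≫ s _ + ρ _ ≫ (S.lift φ s ρ (S.sub (isoRep K)) ≫ X.map (S.ι _) -
        M.map (S.ι _) ≫ φ.app _ ≫ s _)
    else φ.app _ ≫ s _)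
termination_by S.rank K
decreasing_by exact _h.trans_le (S.rank_le (nonempty_iso_isoRep K).some.inv)

variable {k}

/-- Induction on the rank. Naturality along isomorphisms comes from averaging; a non-isomorphism
followed by any `K ≅ R` factors through `ι`, where the correction term and the induction hypothesis
apply. -/
theorem ChainStructure.lift_spec (S : ChainStructure C)
    (hk : ∀ K : C, IsUnit ((Nat.card (K ⟶ K) : ℕ) : k))
    (hend : ∀ (K : C) (f : K ⟶ K), IsIso f) (φ : M ⟶ Y) (π : X ⟶ Y)
    (s : ∀ K, Y.obj K ⟶ X.obj K) (hs : ∀ K, s K ≫ π.app K = 𝟙 _)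
    (ρ : ∀ K, M.obj K ⟶ M.obj (S.sub K)) (hρ : ∀ K, M.map (S.ι K) ≫ ρ K = 𝟙 _) (n : ℕ) (K : C)
    (hK : S.rank K ≤ n) :
    S.lift k φ s ρ K ≫ π.app K = φ.app K ∧
      ∀ H (f : H ⟶ K), M.map f ≫ S.lift k φ s ρ K = S.lift k φ s ρ H ≫ X.map f := by
  classical
  induction n using Nat.strong_induction_on generalizing K with | _ n ih
  set t := S.lift k φ s ρ with ht
  let τ : ∀ R, M.obj R ⟶ X.obj R := fun R => if S.rank (S.sub R) < S.rank R then
      φ.app _ ≫ s _ + ρ _ ≫ (t (S.sub R) ≫ X.map (S.ι _) - M.map (S.ι _) ≫ φ.app _ ≫ s _)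
    else φ.app _ ≫ s _
  have htτ : ∀ (L R : C), R = isoRep L → t L = isoAverage k L (τ R) := by
    rintro L _ rfl
    rw [ht, ChainStructure.lift]
    rfl
  obtain ⟨e⟩ := nonempty_iso_isoRep K
  have hu := isUnit_card_iso hk hend e
  have hRn : S.rank (isoRep K) ≤ n := (S.rank_le e.inv).trans hK
  have hiso : ∀ H (f : H ⟶ K), IsIso f → M.map f ≫ t K = t H ≫ X.map f := fun H f hf => by
    rw [htτ K _ rfl, htτ H _ (isoRep_eq (asIso f)).symm]
    exact map_hom_comp_isoAverage k (asIso f) _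
  have hτ : τ (isoRep K) ≫ π.app _ = φ.app _ := by
    by_cases h : S.rank (S.sub (isoRep K)) < S.rank (isoRep K)
    · have := (ih _ (h.trans_le hRn) _ le_rfl).1
      simp only [τ, if_pos h, Preadditive.add_comp, Preadditive.sub_comp, Category.assoc, hs,
        Category.comp_id, NatTrans.naturality, reassoc_of% this, sub_self, Limits.comp_zero,
        add_zero]
    · simp only [τ, if_neg h, Category.assoc, hs, Category.comp_id]
  refine ⟨?_, fun H f => ?_⟩
  · rw [htτ K _ rfl]
    have := comp_isoAverage_comp hu (τ (isoRep K)) (𝟙 _) (π.app K) (φ.app K) fun u => by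
      simp only [Category.assoc, NatTrans.naturality, reassoc_of% hτ, Category.id_comp]
      rw [← NatTrans.naturality, ← Functor.map_comp_assoc]
      simp
    simpa using this
  · by_cases hf : IsIso f
    · exact hiso H f hf
    rcases S.minimal_or (isoRep K) with h | ⟨hlt, h⟩
    · exact (hf (have := h _ (f ≫ e.hom); IsIso.of_isIso_comp_right f e.hom)).elim
    have ih' := ih _ (hlt.trans_le hRn) _ le_rfl
    have hτ' : M.map (S.ι (isoRep K)) ≫ τ (isoRep K) = t (S.sub (isoRep K)) ≫ X.map (S.ι _) := by
      simp only [τ, if_pos hlt, Preadditive.comp_add, reassoc_of% hρ]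
      abel
    rw [htτ K _ rfl]
    have := comp_isoAverage_comp hu (τ (isoRep K)) (M.map f) (𝟙 _) (t H ≫ X.map f) fun u => by
      obtain ⟨g, hg⟩ := (h _ (f ≫ u.hom)).resolve_left fun hfu =>
        hf (IsIso.of_isIso_comp_right f u.hom)
      have : f = g ≫ S.ι _ ≫ u.inv := by rw [reassoc_of% hg]; simp
      rw [Category.comp_id, ← Functor.map_comp_assoc, ← hg, Functor.map_comp, Category.assoc,
        reassoc_of% hτ', reassoc_of% (ih'.2 _ g), ← Functor.map_comp, ← Functor.map_comp, ← this]
    simpa using this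

/-- A natural transformation from a functor with split monomorphic values lifts along a pointwise
split epimorphism. -/
theorem ChainStructure.exists_lift (S : ChainStructure C)
    (hk : ∀ K : C, IsUnit ((Nat.card (K ⟶ K) : ℕ) : k))
    (hend : ∀ (K : C) (f : K ⟶ K), IsIso f) (hM : ∀ {H K : C} (f : H ⟶ K), IsSplitMono (M.map f))
    (φ : M ⟶ Y) (π : X ⟶ Y) (hπ : ∀ K, IsSplitEpi (π.app K)) : ∃ t : M ⟶ X, t ≫ π = φ := by
  have h := S.lift_spec hk hend φ π (fun K => section_ (π.app K)) (fun K => IsSplitEpi.id _)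
    (fun K => retraction (M.map (S.ι K))) (fun K => IsSplitMono.id _)
  refine ⟨⟨S.lift k φ (fun K => section_ (π.app K)) (fun K => retraction (M.map (S.ι K))),
    fun H K f => (h _ K le_rfl).2 H f⟩, ?_⟩
  ext K
  exact (h _ K le_rfl).1

end Lifting

/-! ### Sufficiency -/

section Sufficiency

theorem isSplitMono_of_injective {k : Type*} [Field k] {X Y : ModuleCat k} (f : X ⟶ Y)
    (hf : Function.Injective f.hom) : IsSplitMono f := by
  obtain ⟨g, hg⟩ := f.hom.exists_leftInverse_of_injective (LinearMap.ker_eq_bot.2 hf)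
  exact .mk' ⟨ModuleCat.ofHom g, ModuleCat.hom_ext hg⟩

theorem isSplitEpi_of_surjective {k : Type*} [Field k] {X Y : ModuleCat k} (f : X ⟶ Y)
    (hf : Function.Surjective f.hom) : IsSplitEpi f := by
  obtain ⟨g, hg⟩ := f.hom.exists_rightInverse_of_surjective (LinearMap.range_eq_top.2 hf)
  exact .mk' ⟨ModuleCat.ofHom g, ModuleCat.hom_ext hg⟩

theorem injective_app {k : Type*} [Field k] {D : Type*} [Category* D] {X Y : D ⥤ ModuleCat k}
    (f : X ⟶ Y) [Mono f] (K : D) : Function.Injective (f.app K).hom :=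
  (ModuleCat.mono_iff_injective _).1 ((NatTrans.mono_iff_mono_app f).1 inferInstance K)

theorem surjective_app {k : Type*} [Field k] {D : Type*} [Category* D] {X Y : D ⥤ ModuleCat k}
    (f : X ⟶ Y) [Epi f] (K : D) : Function.Surjective (f.app K).hom :=
  (ModuleCat.epi_iff_surjective _).1 ((NatTrans.epi_iff_epi_app f).1 inferInstance K)

variable {k : Type w} [Field k] {C : Type u} [Category.{u} C]

/-- If all morphisms of `C` are monomorphisms, then projective functors have injective values. -/
theorem injective_map_of_projective [∀ (H K : C) (f : H ⟶ K), Mono f]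
    (P : C ⥤ ModuleCat.{max u w} k) [Projective P] {H K : C} (f : H ⟶ K) :
    Function.Injective (P.map f).hom := by
  let c : (Σ L, P.obj L) → C := Sigma.fst
  -- `P` is a retract of the free functor on all its elements, and free functors have injective
  -- values because composition with a monomorphism is injective on basis elements.
  let p : freeFunctor k c ⟶ P := freeFunctor.desc fun i => i.2
  have hp : Epi p := (NatTrans.epi_iff_epi_app p).2 fun L => (ModuleCat.epi_iff_surjective _).2
    fun x => ⟨_, freeFunctor.desc_gen (k := k) (c := c) (fun i => i.2) ⟨L, x⟩⟩
  let σ := Projective.factorThru (𝟙 P) p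
  have hσ : σ ≫ p = 𝟙 P := Projective.factorThru_comp _ _
  have hσi : ∀ L, Function.Injective (σ.app L).hom := fun L =>
    have : Mono σ := mono_of_mono_fac hσ
    injective_app σ L
  intro x y hxy
  apply hσi H
  have e : ((freeFunctor k c).map f).hom ((σ.app H).hom x) =
      ((freeFunctor k c).map f).hom ((σ.app H).hom y) := by
    have h : ∀ z, (σ.app K).hom ((P.map f).hom z) =
        ((freeFunctor k c).map f).hom ((σ.app H).hom z) := fun z =>
      NatTrans.naturality_apply σ f z
    rw [← h, ← h, hxy]
  refine Finsupp.mapDomain_injective ?_ e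
  rintro ⟨i, a⟩ ⟨j, b⟩ hab
  obtain ⟨rfl, hab⟩ := Sigma.mk.inj_iff.1 hab
  exact congrArg (Sigma.mk i) ((cancel_mono f).1 (eq_of_heq hab))

/-- A subfunctor of a projective inherits injective values. Over a field these are split, as are the
components of any epimorphism, so `exists_lift` shows it to be projective. -/
theorem ChainStructure.isHereditaryCategory (S : ChainStructure C)
    [∀ H K : C, Finite (H ⟶ K)] [∀ (H K : C) (f : H ⟶ K), Mono f]
    (hk : ∀ K : C, IsUnit ((Nat.card (K ⟶ K) : ℕ) : k))
    (hend : ∀ (K : C) (f : K ⟶ K), IsIso f) :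
    IsHereditaryCategory (C ⥤ ModuleCat.{max u w} k) := by
  intro P Q i _ _
  refine ⟨fun {E X} f e _ => S.exists_lift hk hend (fun {H K} g => isSplitMono_of_injective _ ?_)
    f e fun K => isSplitEpi_of_surjective _ (surjective_app e K)⟩
  intro x y hxy
  apply injective_app i H
  apply injective_map_of_projective P g
  have h : ∀ z, (i.app K).hom ((Q.map g).hom z) = (P.map g).hom ((i.app H).hom z) := fun z =>
    NatTrans.naturality_apply i g z
  rw [← h, ← h, hxy]

/-- The opposite of a linear category is linear. -/
@[reducible]
def linearOpposite (k : Type*) [Semiring k] (A : Type*) [Category* A] [Preadditive A]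
    [Linear k A] : Linear k Aᵒᵖ where
  homModule _ _ :=
    { smul r f := (r • f.unop).op
      one_smul f := congrArg Quiver.Hom.op (one_smul k f.unop)
      mul_smul r s f := congrArg Quiver.Hom.op (mul_smul r s f.unop)
      smul_zero r := congrArg Quiver.Hom.op (smul_zero r)
      smul_add r f g := congrArg Quiver.Hom.op (smul_add r f.unop g.unop)
      add_smul r s f := congrArg Quiver.Hom.op (add_smul r s f.unop)
      zero_smul f := congrArg Quiver.Hom.op (zero_smul k f.unop) }
  smul_comp _ _ _ r f g := congrArg Quiver.Hom.op (Linear.comp_smul _ _ _ g.unop r f.unop)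
  comp_smul _ _ _ f r g := congrArg Quiver.Hom.op (Linear.smul_comp _ _ _ r g.unop f.unop)

/-- A natural transformation to a functor on `Cᵒᵖ` with surjective values extends along
monomorphisms. -/
theorem ChainStructure.exists_extension (S : ChainStructure C) [∀ H K : C, Finite (H ⟶ K)]
    (hk : ∀ K : C, IsUnit ((Nat.card (K ⟶ K) : ℕ) : k))
    (hend : ∀ (K : C) (f : K ⟶ K), IsIso f) {N P Q : Cᵒᵖ ⥤ ModuleCat.{v} k}
    (hN : ∀ {H K : Cᵒᵖ} (f : H ⟶ K), Function.Surjective (N.map f).hom)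
    (g : Q ⟶ N) (i : Q ⟶ P) [Mono i] : ∃ t : P ⟶ N, i ≫ t = g := by
  -- Dualise the target: a contravariant functor with surjective values is a covariant functor to
  -- `(ModuleCat k)ᵒᵖ` with split monomorphic values.
  let := linearOpposite k (ModuleCat.{v} k)
  obtain ⟨t, ht⟩ := S.exists_lift hk hend (M := N.rightOp)
    (fun {H K} f => by
      have := isSplitEpi_of_surjective _ (hN f.op)
      exact inferInstanceAs (IsSplitMono (N.map f.op).op))
    (NatTrans.rightOp g) (NatTrans.rightOp i)
    (fun K => by
      have := isSplitMono_of_injective _ (injective_app i (.op K))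
      exact inferInstanceAs (IsSplitEpi (i.app (.op K)).op))
  refine ⟨NatTrans.removeRightOp t, ?_⟩
  ext K : 2
  exact congrArg (fun η => (NatTrans.app η K.unop).unop) ht

/-- The product over all morphisms `h : H ⟶ K` of the modules `A(H)`, as a contravariant functor
of `K`. -/
noncomputable def cofreeFunctor (A : Cᵒᵖ ⥤ ModuleCat.{max u w} k) :
    Cᵒᵖ ⥤ ModuleCat.{max u w} k where
  obj K := ModuleCat.of k (∀ p : Σ H : C, H ⟶ K.unop, A.obj (.op p.1))
  map f := ModuleCat.ofHom (LinearMap.pi fun p =>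
    LinearMap.proj (φ := fun p : Σ H : C, H ⟶ _ => A.obj (.op p.1)) ⟨p.1, p.2 ≫ f.unop⟩)
  map_id K := by
    ext x p
    change x ⟨p.1, p.2 ≫ 𝟙 _⟩ = x p
    rw [Category.comp_id]
  map_comp f g := by
    ext x p
    change x ⟨p.1, p.2 ≫ g.unop ≫ f.unop⟩ = x ⟨p.1, (p.2 ≫ g.unop) ≫ f.unop⟩
    rw [Category.assoc]

theorem cofreeFunctor_map_surjective [∀ (H K : C) (f : H ⟶ K), Mono f]
    (A : Cᵒᵖ ⥤ ModuleCat.{max u w} k) {K L : Cᵒᵖ} (f : K ⟶ L) :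
    Function.Surjective ((cofreeFunctor A).map f).hom := by
  classical
  intro x
  let x' : ∀ p : Σ H : C, H ⟶ L.unop, A.obj (.op p.1) := x
  -- Extend by zero away from the morphisms that factor through `f`; the factorisation is unique
  -- since `f` is a monomorphism.
  let y : ∀ p : Σ H : C, H ⟶ K.unop, A.obj (.op p.1) := fun p =>
    if h : ∃ q, q ≫ f.unop = p.2 then x' ⟨p.1, h.choose⟩ else 0
  refine ⟨y, funext fun p => ?_⟩
  change y ⟨p.1, p.2 ≫ f.unop⟩ = x' p
  have h : ∃ q, q ≫ f.unop = p.2 ≫ f.unop := ⟨p.2, rfl⟩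
  have h' : h.choose = p.2 := (cancel_mono f.unop).1 h.choose_spec
  let z : (p.1 ⟶ L.unop) → A.obj (.op p.1) := fun q => x' ⟨p.1, q⟩
  exact (dif_pos h).trans (congrArg z h')

/-- The embedding of a functor in a functor with surjective values. -/
noncomputable def toCofreeFunctor (A : Cᵒᵖ ⥤ ModuleCat.{max u w} k) : A ⟶ cofreeFunctor A where
  app K := ModuleCat.ofHom
    (LinearMap.pi fun p : Σ H : C, H ⟶ K.unop => (A.map p.2.op).hom)
  naturality K L f := by
    ext x
    funext p
    change (A.map p.2.op).hom ((A.map f).hom x) = (A.map (p.2 ≫ f.unop).op).hom x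
    rw [op_comp, A.map_comp]
    rfl

instance (A : Cᵒᵖ ⥤ ModuleCat.{max u w} k) : Mono (toCofreeFunctor A) :=
  (NatTrans.mono_iff_mono_app _).2 fun K => (ModuleCat.mono_iff_injective _).2 fun x y h => by
    have := congrFun (β := fun p : Σ H : C, H ⟶ K.unop => A.obj (.op p.1)) h ⟨K.unop, 𝟙 _⟩
    change (A.map (𝟙 K)).hom x = (A.map (𝟙 K)).hom y at this
    simpa using this

/-- A pushout square along a monomorphism in an abelian category is a weak pullback square. -/
theorem exists_lift_of_isPushout {𝒜 : Type*} [Category* 𝒜] [Abelian 𝒜] {A B I J Q : 𝒜} {m : A ⟶ I}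
    {e : A ⟶ B} {r : I ⟶ J} {b : B ⟶ J} (sq : IsPushout m e r b) [Mono m] (u : Q ⟶ I) (f : Q ⟶ B)
    (h : u ≫ r = f ≫ b) : ∃ q : Q ⟶ A, q ≫ e = f := by
  have : Mono (Limits.biprod.lift m (-e) ≫ Limits.biprod.fst) := by
    rwa [Limits.biprod.lift_fst]
  -- As `m` is a monomorphism, `0 → A → I ⊕ B → J` is exact, and `(u, -f)` lands in the kernel of
  -- the last map.
  have : Mono sq.shortComplex.f := mono_of_mono (Limits.biprod.lift m (-e)) Limits.biprod.fst
  have hz : Limits.biprod.lift u (-f) ≫ Limits.biprod.desc r b = 0 := by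
    rw [Limits.biprod.lift_desc, h, Preadditive.neg_comp, add_neg_cancel]
  have hl : sq.exact_shortComplex.lift _ hz ≫ Limits.biprod.lift m (-e) =
    Limits.biprod.lift u (-f) := sq.exact_shortComplex.lift_f _ hz
  refine ⟨sq.exact_shortComplex.lift _ hz, ?_⟩
  have h₂ := congrArg (· ≫ Limits.biprod.snd) hl
  simp only [Category.assoc, Limits.biprod.lift_snd] at h₂
  have h₃ : Limits.biprod.lift m (-e) ≫ Limits.biprod.snd = -e := Limits.biprod.lift_snd _ _
  exact neg_injective ((Preadditive.comp_neg _ _).symm.trans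
    ((congrArg (sq.exact_shortComplex.lift _ hz ≫ ·) h₃).symm.trans h₂))

/-- To lift `f : Q ⟶ B` through `e : A ⟶ B`, embed `A` in its cofree functor `I` and let `J` be the
pushout along `e`. As a quotient of `I`, `J` has surjective values, so `Q ⟶ J` extends to `P`;
projectivity of `P` lifts this to `I`, and the weak pullback property brings the restriction to `Q`
back to `A`. -/
theorem ChainStructure.isHereditaryCategory_op (S : ChainStructure C)
    [∀ H K : C, Finite (H ⟶ K)] [∀ (H K : C) (f : H ⟶ K), Mono f]
    (hk : ∀ K : C, IsUnit ((Nat.card (K ⟶ K) : ℕ) : k))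
    (hend : ∀ (K : C) (f : K ⟶ K), IsIso f) :
    IsHereditaryCategory (Cᵒᵖ ⥤ ModuleCat.{max u w} k) := by
  intro P Q i _ _
  refine ⟨fun {A B} f e _ => ?_⟩
  have sq := IsPushout.of_hasPushout (toCofreeFunctor A) e
  let r := Limits.pushout.inl (toCofreeFunctor A) e
  let b := Limits.pushout.inr (toCofreeFunctor A) e
  have hr : ∀ {H K : Cᵒᵖ} (g : H ⟶ K), Function.Surjective
      ((Limits.pushout (toCofreeFunctor A) e).map g).hom := fun {H K} g x => by
    obtain ⟨y, rfl⟩ := surjective_app r K x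
    obtain ⟨z, rfl⟩ := cofreeFunctor_map_surjective A g y
    exact ⟨(r.app H).hom z, (NatTrans.naturality_apply r g z).symm⟩
  obtain ⟨t, ht⟩ := S.exists_extension hk hend hr (f ≫ b) i
  let s := Projective.factorThru t r
  have hs : s ≫ r = t := Projective.factorThru_comp _ _
  exact exists_lift_of_isPushout sq (i ≫ s) f (by rw [Category.assoc, hs, ht])

end Sufficiency

/-! ### Non-degenerate modules over a category algebra are functors -/

namespace NondegModule

variable {S T : Type u} [NonUnitalRing S] [NonUnitalRing T]

theorem act_mul (M : NondegModule S) (a b : S) (m : M.carrier) :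
    M.act (a * b) m = M.act a (M.act b m) := by
  rw [map_mul]
  rfl

/-- A bijective homomorphism is an isomorphism. -/
theorem isIso_of_bijective {M N : NondegModule S} (f : M ⟶ N)
    (hf : Function.Bijective (Hom.toAddMonoidHom f)) : IsIso f := by
  let e := AddEquiv.ofBijective (Hom.toAddMonoidHom f) hf
  let g : N ⟶ M := ⟨e.symm.toAddMonoidHom, fun a n => by
    apply hf.1
    rw [Hom.map_act]
    exact (e.apply_symm_apply _).trans (congrArg _ (e.apply_symm_apply _).symm)⟩
  exact ⟨g, Hom.ext (AddMonoidHom.ext e.symm_apply_apply),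
    Hom.ext (AddMonoidHom.ext e.apply_symm_apply)⟩

/-- Restriction of scalars along a ring isomorphism. -/
def restrict (e : S ≃+* T) : NondegModule T ⥤ NondegModule S where
  obj M :=
    { carrier := M.carrier
      act := M.act.comp (e : S →ₙ+* T)
      nondegenerate := by
        rw [← M.nondegenerate]
        congr 1
        ext x
        exact ⟨fun ⟨a, m, h⟩ => ⟨e a, m, h⟩, fun ⟨a, m, h⟩ => ⟨e.symm a, m, by
          rw [← h]
          exact congrArg (fun b => M.act b m) (e.apply_symm_apply a)⟩⟩ }
  map f := ⟨f.toAddMonoidHom, fun a m => f.map_act (e a) m⟩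

/-- Isomorphic rings have equivalent categories of non-degenerate modules. -/
def restrictEquivalence (e : S ≃+* T) : NondegModule T ≌ NondegModule S where
  functor := restrict e
  inverse := restrict e.symm
  unitIso := NatIso.ofComponents fun M =>
    { hom := ⟨AddMonoidHom.id _, fun a m =>
        congrArg (fun b => M.act b m) (e.apply_symm_apply a).symm⟩
      inv := ⟨AddMonoidHom.id _, fun a m =>
        congrArg (fun b => M.act b m) (e.apply_symm_apply a)⟩ }
  counitIso := NatIso.ofComponents fun M =>
    { hom := ⟨AddMonoidHom.id _, fun a m =>
        congrArg (fun b => M.act b m) (e.symm_apply_apply a)⟩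
      inv := ⟨AddMonoidHom.id _, fun a m =>
        congrArg (fun b => M.act b m) (e.symm_apply_apply a).symm⟩ }

end NondegModule

theorem isLeftHereditary_congr {S T : Type u} [NonUnitalRing S] [NonUnitalRing T] (e : S ≃+* T) :
    IsLeftHereditary S ↔ IsLeftHereditary T :=
  (isHereditaryCategory_congr (NondegModule.restrictEquivalence e)).symm

section FunctorModule

open CategoryAlgebra

variable (k : Type w) [Field k] {D : Type u} [Category.{u} D]

namespace functorModule

variable {k}

open Classical in
/-- The action of the category algebra on the direct sum of the values of a functor. -/
noncomputable def actLin (X : D ⥤ ModuleCat.{max u w} k) :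
    CategoryAlgebra k D →ₗ[k] Module.End k (Π₀ d, X.obj d) :=
  Finsupp.linearCombination k fun f : Σ x y : D, x ⟶ y =>
    DFinsupp.lsingle f.2.1 ∘ₗ (X.map f.2.2).hom ∘ₗ DFinsupp.lapply f.1

open Classical in
theorem actLin_of (X : D ⥤ ModuleCat.{max u w} k) {d d' : D} (f : d ⟶ d') (x : Π₀ d, X.obj d) :
    actLin X (of k f) x = DFinsupp.single d' ((X.map f).hom (x d)) := by
  have : actLin X (of k f) =
      DFinsupp.lsingle d' ∘ₗ (X.map f).hom ∘ₗ DFinsupp.lapply d :=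
    (Finsupp.linearCombination_single k _ _).trans (one_smul _ _)
  rw [this]
  rfl

theorem actLin_mul (X : D ⥤ ModuleCat.{max u w} k) (a b : CategoryAlgebra k D)
    (x : Π₀ d, X.obj d) : actLin X (a * b) x = actLin X a (actLin X b x) := by
  classical
  induction a using induction_of with
  | h0 => simp
  | hadd a a' h h' => rw [add_mul, map_add, map_add, LinearMap.add_apply, LinearMap.add_apply, h, h']
  | hof r d d' f =>
    rw [smul_mul', map_smul, map_smul, LinearMap.smul_apply, LinearMap.smul_apply]
    congr 1
    induction b using induction_of with
    | h0 => simp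
    | hadd b b' h h' => rw [mul_add, map_add, map_add, LinearMap.add_apply, LinearMap.add_apply, h,
        h', map_add]
    | hof s c c' g =>
      rw [mul_smul', map_smul, map_smul, LinearMap.smul_apply, LinearMap.smul_apply, map_smul]
      congr 1
      rw [actLin_of, actLin_of]
      by_cases h : c' = d
      · subst h
        rw [of_mul_of, actLin_of, DFinsupp.single_eq_same, Functor.map_comp]
        rfl
      · rw [of_mul_of_of_ne k _ _ h, DFinsupp.single_eq_of_ne (Ne.symm h)]
        simp

open Classical in
/-- The non-degenerate module `⨁ X(d)`. -/
noncomputable def obj (X : D ⥤ ModuleCat.{max u w} k) :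
    NondegModule.{max u w} (CategoryAlgebra k D) where
  carrier := Π₀ d, X.obj d
  act :=
    { toFun := fun a => (actLin X a).toAddMonoidHom
      map_mul' := fun a b => AddMonoidHom.ext (actLin_mul X a b)
      map_zero' := by rw [map_zero]; rfl
      map_add' := fun a b => by rw [map_add]; rfl }
  nondegenerate := by
    rw [eq_top_iff]
    intro x _
    induction x using DFinsupp.induction with
    | h0 => exact zero_mem _
    | ha d m x _ _ hx =>
      refine add_mem (AddSubgroup.subset_closure ⟨of k (𝟙 d), DFinsupp.single d m, ?_⟩) (hx trivial)
      refine (actLin_of X (𝟙 d) (DFinsupp.single d m)).trans ?_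
      simp

/-- The map of direct sums induced by a natural transformation. -/
noncomputable def map {X Y : D ⥤ ModuleCat.{max u w} k} (f : X ⟶ Y) : obj X ⟶ obj Y where
  toAddMonoidHom :=
    (DFinsupp.mapRange.linearMap (fun d => (f.app d).hom) :
      (Π₀ d, X.obj d) →ₗ[k] (Π₀ d, Y.obj d)).toAddMonoidHom
  map_act a (x : Π₀ d, X.obj d) := by
    classical
    change DFinsupp.mapRange.linearMap (fun d => (f.app d).hom) (actLin X a x) =
      actLin Y a (DFinsupp.mapRange.linearMap (fun d => (f.app d).hom) x)
    induction a using induction_of with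
    | h0 => rw [map_zero, map_zero, LinearMap.zero_apply, map_zero, LinearMap.zero_apply]
    | hadd a a' h h' =>
      rw [map_add, map_add, LinearMap.add_apply, LinearMap.add_apply, map_add, h, h']
    | hof r d d' g =>
      rw [map_smul, map_smul, LinearMap.smul_apply, LinearMap.smul_apply, map_smul]
      congr 1
      rw [actLin_of, actLin_of]
      simp only [DFinsupp.mapRange.linearMap_apply, DFinsupp.mapRange_single,
        DFinsupp.mapRange_apply]
      congr 1
      exact NatTrans.naturality_apply f g (x d)

end functorModule

/-- The functor from `k`-linear representations of `D` to non-degenerate modules over `kD`. -/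
noncomputable def functorModule :
    (D ⥤ ModuleCat.{max u w} k) ⥤ NondegModule.{max u w} (CategoryAlgebra k D) where
  obj := functorModule.obj
  map := functorModule.map
  map_id _ := NondegModule.Hom.ext <| AddMonoidHom.ext fun _ => DFinsupp.ext fun _ => rfl
  map_comp _ _ := NondegModule.Hom.ext <| AddMonoidHom.ext fun _ => DFinsupp.ext fun _ => rfl

instance : (functorModule k (D := D)).Faithful where
  map_injective {X Y f g} h := by
    classical
    ext d x
    have := congrArg (fun η : functorModule.obj X ⟶ functorModule.obj Y =>
      (show Π₀ d, Y.obj d from NondegModule.Hom.toAddMonoidHom η (DFinsupp.single d x)) d) h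
    change (f.app d).hom ((DFinsupp.single d x : Π₀ d, X.obj d) d) =
      (g.app d).hom ((DFinsupp.single d x : Π₀ d, X.obj d) d) at this
    simpa using this

/-- Module maps are only additive; linearity over `k` of the components is recovered from the action
of the elements `r • 1_d`. -/
instance : (functorModule k (D := D)).Full where
  map_surjective {X Y} g := by
    classical
    let γ : (Π₀ d, X.obj d) →+ (Π₀ d, Y.obj d) := NondegModule.Hom.toAddMonoidHom g
    have hγ : ∀ a x, γ (functorModule.actLin X a x) = functorModule.actLin Y a (γ x) :=
      NondegModule.Hom.map_act g
    have hs : ∀ {d d'} (f : d ⟶ d') (r : k) (x : X.obj d),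
        γ (DFinsupp.single d' (r • (X.map f).hom x)) =
          r • DFinsupp.single d' ((Y.map f).hom (γ (DFinsupp.single d x) d)) := fun {d d'} f r x => by
      have h := hγ (r • of k f) (DFinsupp.single d x)
      rwa [map_smul, map_smul, LinearMap.smul_apply, LinearMap.smul_apply, functorModule.actLin_of,
        functorModule.actLin_of, DFinsupp.single_eq_same, ← DFinsupp.single_smul] at h
    let f : X ⟶ Y :=
      { app := fun d => ModuleCat.ofHom
          { toFun := fun x => γ (DFinsupp.single d x) d
            map_add' := fun x y => by rw [DFinsupp.single_add, map_add, DFinsupp.add_apply]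
            map_smul' := fun r x => by
              have := congrArg (fun y : Π₀ d, Y.obj d => y d) (hs (𝟙 d) r x)
              simpa using this }
        naturality := fun d d' f => by
          ext x
          have := congrArg (fun y : Π₀ d, Y.obj d => y d') (hs f 1 x)
          simpa using this }
    refine ⟨f, NondegModule.Hom.ext <| DFinsupp.addHom_ext fun d x => ?_⟩
    change DFinsupp.mapRange.linearMap (fun d => (f.app d).hom) (DFinsupp.single d x) =
      γ (DFinsupp.single d x)
    have := hs (𝟙 d) 1 x
    rw [DFinsupp.mapRange.linearMap_apply, DFinsupp.mapRange_single]
    rw [X.map_id, Y.map_id, one_smul, one_smul] at this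
    exact this.symm

end FunctorModule

/-! ### Every non-degenerate module is the direct sum of its components. -/

section Components

open CategoryAlgebra

variable {k : Type w} [Field k] {D : Type u} [Category.{u} D]
  (M : NondegModule.{max u w} (CategoryAlgebra k D))

namespace NondegModule

theorem act_of_act_of {x y z : D} (f : x ⟶ y) (g : y ⟶ z) (m : M.carrier) :
    M.act (of k g) (M.act (of k f) m) = M.act (of k (f ≫ g)) m := by
  rw [← act_mul, of_mul_of]

/-- The subgroup `e_d M`. -/
def component (d : D) : AddSubgroup M.carrier where
  carrier := {m | M.act (of k (𝟙 d)) m = m}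
  add_mem' {a b} ha hb := (map_add _ a b).trans (congrArg₂ _ ha hb)
  zero_mem' := map_zero _
  neg_mem' {a} ha := (map_neg _ a).trans (congrArg _ ha)

variable {M}

theorem act_smul_of_mem {d d' : D} (r : k) (f : d ⟶ d') (m : M.carrier) :
    M.act (r • of k f) m ∈ M.component d' := by
  change M.act _ (M.act _ m) = _
  rw [← act_mul, mul_smul', of_mul_of, Category.comp_id]

theorem act_of_mem {d d' : D} (f : d ⟶ d') (m : M.carrier) :
    M.act (of k f) m ∈ M.component d' := by
  simpa using act_smul_of_mem 1 f m

/-- `M` carries no given `k`-structure; on `e_d M` a scalar `r` acts through `r • 1_d`. -/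
noncomputable instance (d : D) : Module k (M.component d) where
  smul r m := ⟨M.act (r • of k (𝟙 d)) m, act_smul_of_mem r _ _⟩
  one_smul m := Subtype.ext (by
    change M.act ((1 : k) • of k (𝟙 d)) m = m
    rw [one_smul]
    exact m.2)
  mul_smul r s m := Subtype.ext (by
    change M.act ((r * s) • of k (𝟙 d)) m = M.act (r • of k (𝟙 d)) (M.act (s • of k (𝟙 d)) m)
    rw [← act_mul, smul_mul', mul_smul', of_mul_of, Category.comp_id, mul_smul])
  smul_zero r := Subtype.ext (map_zero _)
  smul_add r m n := Subtype.ext (map_add _ _ _)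
  add_smul r s m := Subtype.ext (by
    change M.act ((r + s) • of k (𝟙 d)) m = M.act (r • of k (𝟙 d)) m + M.act (s • of k (𝟙 d)) m
    rw [add_smul, map_add]
    rfl)
  zero_smul m := Subtype.ext (by
    change M.act ((0 : k) • of k (𝟙 d)) m = 0
    rw [zero_smul, map_zero]
    rfl)

variable (M)

/-- The functor `d ↦ e_d M`. -/
noncomputable def toFunctor : D ⥤ ModuleCat.{max u w} k where
  obj d := ModuleCat.of k (M.component d)
  map {d d'} f := ModuleCat.ofHom
    { toFun := fun m : M.component d => (⟨M.act (of k f) m, act_of_mem f _⟩ : M.component d')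
      map_add' := fun m n => Subtype.ext (map_add _ _ _)
      map_smul' := fun r m => Subtype.ext (by
        change M.act (of k f) (M.act (r • of k (𝟙 d)) m) =
          M.act (r • of k (𝟙 d')) (M.act (of k f) m)
        rw [← act_mul, ← act_mul, mul_smul', smul_mul', of_mul_of, of_mul_of, Category.comp_id,
          Category.id_comp]) }
  map_id d := ModuleCat.hom_ext <| LinearMap.ext fun m : M.component d => Subtype.ext m.2
  map_comp f g := ModuleCat.hom_ext <| LinearMap.ext fun m : M.component _ =>
    Subtype.ext (M.act_of_act_of f g m).symm

/-- The inclusion `e_d M → M`. -/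
noncomputable def componentHom (d : D) : M.toFunctor.obj d →+ M.carrier := (M.component d).subtype

variable {M}

theorem componentHom_injective (d : D) : Function.Injective (M.componentHom d) :=
  Subtype.val_injective

theorem act_id_componentHom (d : D) (m : M.toFunctor.obj d) :
    M.act (of k (𝟙 d)) (M.componentHom d m) = M.componentHom d m :=
  Subtype.property (p := (· ∈ M.component d)) m

theorem componentHom_smul_map {d d' : D} (r : k) (f : d ⟶ d') (m : M.toFunctor.obj d) :
    M.componentHom d' (r • (M.toFunctor.map f).hom m) =
      M.act (r • of k f) (M.componentHom d m) := by
  change M.act (r • of k (𝟙 d')) (M.act (of k f) _) = _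
  rw [← act_mul, smul_mul', of_mul_of, Category.comp_id]
  rfl

variable (M)

open Classical in
/-- The sum map `⨁ e_d M → M`. -/
noncomputable def sumComponents : (Π₀ d, M.toFunctor.obj d) →+ M.carrier :=
  DFinsupp.sumAddHom M.componentHom

open Classical in
theorem sumComponents_single (d : D) (m : M.toFunctor.obj d) :
    M.sumComponents (DFinsupp.single d m) = M.componentHom d m :=
  DFinsupp.sumAddHom_single _ _ _

theorem act_of_sumComponents {d d' : D} (f : d ⟶ d') (x : Π₀ d, M.toFunctor.obj d) :
    M.act (of k f) (M.sumComponents x) = M.act (of k f) (M.componentHom d (x d)) := by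
  classical
  induction x using DFinsupp.induction with
  | h0 => rw [map_zero, DFinsupp.zero_apply, map_zero, map_zero, map_zero]
  | ha c m x _ _ hx =>
    rw [map_add, map_add, hx, sumComponents_single, DFinsupp.add_apply, map_add, map_add]
    congr 1
    by_cases h : c = d
    · subst h
      rw [DFinsupp.single_eq_same]
    · rw [DFinsupp.single_eq_of_ne (Ne.symm h), map_zero, map_zero, ← act_id_componentHom,
        ← act_mul, of_mul_of_of_ne k _ _ h, map_zero]
      rfl

theorem sumComponents_actLin (a : CategoryAlgebra k D) (x : Π₀ d, M.toFunctor.obj d) :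
    M.sumComponents (functorModule.actLin M.toFunctor a x) = M.act a (M.sumComponents x) := by
  classical
  induction a using induction_of with
  | h0 => simp
  | hadd a a' h h' => rw [map_add, map_add, LinearMap.add_apply, map_add, h, h']; rfl
  | hof r d d' f =>
    rw [map_smul, LinearMap.smul_apply, functorModule.actLin_of, ← DFinsupp.single_smul,
      sumComponents_single, componentHom_smul_map]
    have e : r • of k f = (r • of k (𝟙 d')) * of k f := by
      rw [smul_mul', of_mul_of, Category.comp_id]
    rw [e, act_mul, act_mul, act_of_sumComponents]

/-- The orthogonal idempotents `e_d` recover each summand, whence injectivity. Each multiple of a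
morphism acts into one component, so surjectivity is exactly `SM = M`. -/
theorem sumComponents_bijective : Function.Bijective M.sumComponents := by
  classical
  constructor
  · rw [injective_iff_map_eq_zero]
    intro x hx
    refine DFinsupp.ext fun d => componentHom_injective d ?_
    rw [← act_id_componentHom, ← act_of_sumComponents, hx, map_zero, DFinsupp.zero_apply, map_zero]
  · rw [← AddMonoidHom.range_eq_top, eq_top_iff, ← M.nondegenerate, AddSubgroup.closure_le]
    rintro _ ⟨a, m, rfl⟩
    change M.act a m ∈ M.sumComponents.range
    induction a using induction_of with
    | h0 => rw [map_zero]; exact zero_mem _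
    | hadd a a' h h' => rw [map_add]; exact add_mem h h'
    | hof r d d' f => exact ⟨_, M.sumComponents_single d' ⟨_, act_smul_of_mem r f m⟩⟩

end NondegModule

instance : (functorModule k (D := D)).EssSurj where
  mem_essImage M := by
    let f : functorModule.obj M.toFunctor ⟶ M := ⟨M.sumComponents, M.sumComponents_actLin⟩
    have : IsIso f := NondegModule.isIso_of_bijective f M.sumComponents_bijective
    exact ⟨M.toFunctor, ⟨@asIso _ _ _ _ f this⟩⟩

instance : (functorModule k (D := D)).IsEquivalence where

variable (k D) in
theorem isLeftHereditary_categoryAlgebra_iff :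
    IsLeftHereditary (CategoryAlgebra k D) ↔
      IsHereditaryCategory (D ⥤ ModuleCat.{max u w} k) :=
  (isHereditaryCategory_congr (functorModule k (D := D)).asEquivalence).symm

end Components

/-! ### Right modules as representations of the opposite category. -/

section Opposite

open CategoryAlgebra

variable (k : Type w) [Field k] (D : Type u) [Category.{u} D]

/-- Morphisms of the opposite category. -/
def opMorphismEquiv : (Σ x y : Dᵒᵖ, x ⟶ y) ≃ (Σ x y : D, x ⟶ y) where
  toFun f := ⟨f.2.1.unop, f.1.unop, f.2.2.unop⟩
  invFun f := ⟨.op f.2.1, .op f.1, f.2.2.op⟩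

/-- The linear isomorphism `k(Dᵒᵖ) ≃ kD`. -/
noncomputable def opLinearEquiv : CategoryAlgebra k Dᵒᵖ ≃ₗ[k] CategoryAlgebra k D :=
  Finsupp.domLCongr (opMorphismEquiv D)

variable {D}

theorem opLinearEquiv_of {x y : Dᵒᵖ} (f : x ⟶ y) : opLinearEquiv k D (of k f) = of k f.unop :=
  Finsupp.domLCongr_single _ _ _

theorem opLinearEquiv_mul (a b : CategoryAlgebra k Dᵒᵖ) :
    opLinearEquiv k D (a * b) = opLinearEquiv k D b * opLinearEquiv k D a := by
  induction a using induction_of with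
  | h0 => simp
  | hadd a a' h h' => rw [add_mul, map_add, map_add, mul_add, h, h']
  | hof r d d' f =>
    rw [smul_mul', map_smul, map_smul, mul_smul']
    congr 1
    induction b using induction_of with
    | h0 => simp
    | hadd b b' h h' => rw [mul_add, map_add, map_add, add_mul, h, h']
    | hof s c c' g =>
      rw [mul_smul', map_smul, map_smul, smul_mul']
      congr 1
      rw [opLinearEquiv_of, opLinearEquiv_of]
      by_cases h : c' = d
      · subst h
        rw [of_mul_of, of_mul_of, opLinearEquiv_of, unop_comp]
      · rw [of_mul_of_of_ne k _ _ h, of_mul_of_of_ne k _ _ fun h' => h (Opposite.unop_injective h'.symm),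
          map_zero]

variable (D)

/-- The category algebra of the opposite category is the opposite ring. -/
noncomputable def opRingEquiv : CategoryAlgebra k Dᵒᵖ ≃+* (CategoryAlgebra k D)ᵐᵒᵖ :=
  { (opLinearEquiv k D).toAddEquiv.trans MulOpposite.opAddEquiv with
    map_mul' := fun a b => congrArg MulOpposite.op (opLinearEquiv_mul k a b) }

theorem isRightHereditary_categoryAlgebra_iff :
    IsRightHereditary (CategoryAlgebra k D) ↔
      IsHereditaryCategory (Dᵒᵖ ⥤ ModuleCat.{max u w} k) :=
  (isLeftHereditary_congr (opRingEquiv k D)).symm.trans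
    (isLeftHereditary_categoryAlgebra_iff k Dᵒᵖ)

end Opposite

/-! ### The Quillen category -/

section QuillenChain

variable {G : Type u} [Group G] {F : FiniteSubgroupFamily G}

theorem exists_greatest_proper_subgroup (K : Subgroup G) [Finite K]
    (h : ∀ A B : Subgroup G, A ≤ K → B ≤ K → A ≤ B ∨ B ≤ A) (hK : K ≠ ⊥) :
    ∃ L < K, ∀ A < K, A ≤ L := by
  have : Finite (Set.Iio K) :=
    Finite.of_injective (fun A : Set.Iio K => A.1.subgroupOf K) fun A B hAB => Subtype.ext <| by
      rw [← Subgroup.map_subgroupOf_eq_of_le A.2.le, ← Subgroup.map_subgroupOf_eq_of_le B.2.le]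
      exact congrArg _ hAB
  have : Nonempty (Set.Iio K) := ⟨⟨⊥, bot_lt_iff_ne_bot.2 hK⟩⟩
  obtain ⟨L, hL⟩ := Finite.exists_max fun A : Set.Iio K => Nat.card A.1
  refine ⟨L.1, L.2, fun A hA => ?_⟩
  rcases h A L.1 hA.le L.2.le with hAL | hAL
  · exact hAL
  · have : Finite A := Finite.of_injective _ (Subgroup.inclusion_injective hA.le)
    exact (Subgroup.eq_of_le_of_card_ge hAL (hL ⟨A, hA⟩)).ge

/-- If the subgroups of every member of `F` form a chain, then the greatest proper subgroups make
the Quillen category a category with a chain structure. -/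
theorem nonempty_chainStructure
    (h : ∀ K ∈ F.carrier, ∀ A B : Subgroup G, A ≤ K → B ≤ K → A ≤ B ∨ B ≤ A) :
    Nonempty (ChainStructure (QuillenCategory F)) := by
  have key : ∀ K : QuillenCategory F, ∃ (L : QuillenCategory F) (j : L ⟶ K),
      (∀ H (f : H ⟶ K), IsIso f) ∨
        (Nat.card L.1 < Nat.card K.1 ∧ ∀ H (f : H ⟶ K), IsIso f ∨ ∃ g, g ≫ j = f) := fun K => by
    by_cases hK : K.1 = ⊥
    · refine ⟨K, 𝟙 K, .inl fun H f => QuillenCategory.isIso_of_surjective f fun x => ⟨1, ?_⟩⟩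
      have : Subsingleton K.1 := by rw [hK]; infer_instance
      exact Subsingleton.elim _ _
    · obtain ⟨L, hLK, hL⟩ := exists_greatest_proper_subgroup K.1 (h K.1 K.2) hK
      let L' : QuillenCategory F := ⟨L, F.subgroup_mem _ K.2 _ hLK.le⟩
      refine ⟨L', QuillenCategory.incl hLK.le, .inr ⟨?_, fun H f => ?_⟩⟩
      · by_contra! hc
        exact hLK.ne (Subgroup.eq_of_le_of_card_ge hLK.le hc)
      · by_cases hf : Function.Surjective (QuillenHom.val f)
        · exact .inl (QuillenCategory.isIso_of_surjective f hf)
        · right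
          apply QuillenCategory.exists_comp_incl (K' := L') hLK.le
          obtain ⟨A, hA⟩ := QuillenHom.exists_range f
          have hAK : A < K.1 := by
            refine lt_of_le_of_ne (fun a ha => ?_) ?_
            · obtain ⟨x, hx⟩ := (hA a).1 ha
              exact hx ▸ SetLike.coe_mem _
            · rintro rfl
              refine hf fun y => ?_
              obtain ⟨x, hx⟩ := (hA y).1 y.2
              exact ⟨x, Subtype.ext hx⟩
          exact fun x => hL A hAK ((hA _).2 ⟨x, rfl⟩)
  choose L j hj using key
  exact ⟨⟨fun K => Nat.card K.1, QuillenCategory.card_le, L, j, hj⟩⟩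

end QuillenChain

end QuillenHereditary

/-! ### The criterion for both sides. -/

open QuillenHereditary in
theorem QuillenHereditary.isHereditaryCategory_quillen {k : Type w} [Field k] {G : Type u} [Group G]
    (F : FiniteSubgroupFamily G)
    (h : (∀ K ∈ F.carrier, IsCyclic K ∧ ∃ p n : ℕ, p.Prime ∧ Nat.card K = p ^ n) ∧
      (∀ K ∈ F.carrier, IsUnit ((Nat.card (NormalizerModCentralizer K) : ℕ) : k))) :
    IsHereditaryCategory (QuillenCategory F ⥤ ModuleCat.{max u w} k) ∧
      IsHereditaryCategory ((QuillenCategory F)ᵒᵖ ⥤ ModuleCat.{max u w} k) := by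
  obtain ⟨S⟩ := nonempty_chainStructure fun K hK =>
    have := F.finite K hK
    (isCyclic_and_card_eq_prime_pow_iff K).1 (h.1 K hK)
  have hk : ∀ K : QuillenCategory F, IsUnit ((Nat.card (K ⟶ K) : ℕ) : k) := fun K => by
    rw [← QuillenCategory.card_normalizerModCentralizer]
    exact h.2 K.1 K.2
  exact ⟨S.isHereditaryCategory hk fun _ => QuillenCategory.isIso_end,
    S.isHereditaryCategory_op hk fun _ => QuillenCategory.isIso_end⟩

theorem mainTheorem8 {k : Type w} [Field k] {G : Type u} [Group G]
    (F : QuillenHereditary.FiniteSubgroupFamily G) :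
    (QuillenHereditary.IsLeftHereditary
        (QuillenHereditary.CategoryAlgebra k (QuillenHereditary.QuillenCategory F)) ↔
      (∀ K ∈ F.carrier, IsCyclic K ∧ ∃ p n : ℕ, p.Prime ∧ Nat.card K = p ^ n) ∧
      (∀ K ∈ F.carrier,
        IsUnit ((Nat.card (QuillenHereditary.NormalizerModCentralizer K) : ℕ) : k))) ∧
    (QuillenHereditary.IsRightHereditary
        (QuillenHereditary.CategoryAlgebra k (QuillenHereditary.QuillenCategory F)) ↔
      QuillenHereditary.IsLeftHereditary
        (QuillenHereditary.CategoryAlgebra k (QuillenHereditary.QuillenCategory F))) := by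
  open QuillenHereditary in
  rw [isRightHereditary_categoryAlgebra_iff, isLeftHereditary_categoryAlgebra_iff]
  have hl : IsHereditaryCategory (QuillenCategory F ⥤ ModuleCat.{max u w} k) →
      (∀ K ∈ F.carrier, IsCyclic K ∧ ∃ p n : ℕ, p.Prime ∧ Nat.card K = p ^ n) ∧
      (∀ K ∈ F.carrier, IsUnit ((Nat.card (NormalizerModCentralizer K) : ℕ) : k)) := fun h => by
    refine ⟨fun K hK => ?_, fun K hK => ?_⟩
    · have := F.finite K hK
      exact (isCyclic_and_card_eq_prime_pow_iff K).2 fun A B hA hB =>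
        total_of_isHereditaryCategory h hK hA hB
    · rw [QuillenCategory.card_normalizerModCentralizer (F := F) ⟨K, hK⟩]
      exact h.isUnit_card_end _ fun f => QuillenCategory.isIso_end f
  have hr : IsHereditaryCategory ((QuillenCategory F)ᵒᵖ ⥤ ModuleCat.{max u w} k) →
      (∀ K ∈ F.carrier, IsCyclic K ∧ ∃ p n : ℕ, p.Prime ∧ Nat.card K = p ^ n) ∧
      (∀ K ∈ F.carrier, IsUnit ((Nat.card (NormalizerModCentralizer K) : ℕ) : k)) := fun h => by
    refine ⟨fun K hK => ?_, fun K hK => ?_⟩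
    · have := F.finite K hK
      exact (isCyclic_and_card_eq_prime_pow_iff K).2 fun A B hA hB =>
        total_of_isHereditaryCategory_op h hK hA hB
    · let K' : QuillenCategory F := ⟨K, hK⟩
      let e : (Opposite.op K' ⟶ Opposite.op K') ≃ (K' ⟶ K') := opEquiv _ _
      have : Finite (Opposite.op K' ⟶ Opposite.op K') := Finite.of_equiv _ e.symm
      rw [QuillenCategory.card_normalizerModCentralizer K', ← Nat.card_congr e]
      exact h.isUnit_card_end _ fun f =>
        (isIso_unop_iff f).1 (QuillenCategory.isIso_end f.unop)
  exact ⟨⟨hl, fun h => (isHereditaryCategory_quillen F h).1⟩,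
    fun h => (isHereditaryCategory_quillen F (hr h)).1,
    fun h => (isHereditaryCategory_quillen F (hl h)).2⟩
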